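/- **Conventions.** Let $G$ be a finite abelian group with group of characters $\widehat G$. For $K\subseteq\widehat G$ and $\rho>0$, the Bohr set of rank $|K|$ and width $\rho$ is $B(K,\rho)=\{x\in G:|\gamma(x)-1|\le\rho\text{ for all }\gamma\in K\}$. It is *regular* if for all $\epsilon\in(0,1/(100|K|))$ one has $|B(K,\rho(1+\epsilon))|\le|B(K,\rho)|(1+100|K|\epsilon)$ and $|B(K,\rho(1-\epsilon))|\ge|B(K,\rho)|(1-100|K|\epsilon)$ (if $K=\emptyset$ the Bohr set is $G$ and is regular). The VC-dimension of $A\subseteq G$ is the largest size of a set shattered by the family of translates $\{g+A:g\in G\}$. For $A\ne\emptyset$ put $\mu_A(x)=1_A(x)|G|/|A|$, and let $f*g(x)=\frac1{|G|}\sum_{y\in G}f(y)g(x-y)$. Logarithms are natural. **Proposition (relative almost periodicity for sets of bounded VC-dimension).** There are absolute constants $C_0,c_0>0$ such that the following holds. Let $G$ be a finite abelian group, $\eta,\rho,\sigma\in(0,1]$, $d\in\mathbb N$ and $C\in\mathbb R$. Let $A\subseteq G$ be a non-empty set of VC-dimension at most $d$, let $B=B(K,\rho)$ be a Bohr set, and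 let $S\subseteq B$ have relative density $\sigma=|S|/|B|$ and satisfy $|A+S|\le C|A|$. Put $\kappa=0$ if $B(K,\rho)$ is regular, and $\kappa=|K|$ otherwise. Then there are a real number $t'>0$ with $$t'\le C_0\bigl(\log(2/\sigma)+\eta^{-2}\,d\,\log(2/\eta)^2\log C+\kappa\bigr)$$ and a regular Bohr set $B'=B(K',\rho')\subseteq B$ with $$K'\supseteq K,\qquad |K'|\le|K|+t',\qquad \frac{c_0\,\rho\,\eta}{\max(1,|K|)^2\,t'}\le\rho'\le\rho,$$ such that for all $x\in G$ and all $t\in B'$, $$|\mu_A*1_{-A}(x+t)-\mu_A*1_{-A}(x)|\le\eta.$$ -/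

import Mathlib

open scoped Pointwise

noncomputable section

/-- The Bohr set `B(K, ρ) = {x : |γ(x) - 1| ≤ ρ for all γ ∈ K}` in a finite abelian group `G`.
Its rank is `K.card` and its width is `ρ`. Characters of a finite group into `ℂ` automatically
take values in the unit circle. -/
def bohrSet {G : Type*} [AddCommGroup G] [Fintype G]
    (K : Finset (AddChar G ℂ)) (ρ : ℝ) : Finset G :=
  open Classical in Finset.univ.filter fun x => ∀ γ ∈ K, ‖γ x - 1‖ ≤ ρ

/-- Regularity of the Bohr set `B(K, ρ)`. (For `K = ∅` every `B(K, ρ)` is the whole group, and the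
condition holds.) -/
def IsRegularBohr {G : Type*} [AddCommGroup G] [Fintype G]
    (K : Finset (AddChar G ℂ)) (ρ : ℝ) : Prop :=
  ∀ ε : ℝ, 0 < ε → ε < 1 / (100 * (K.card : ℝ)) →
    ((bohrSet K (ρ * (1 + ε))).card : ℝ)
        ≤ ((bohrSet K ρ).card : ℝ) * (1 + 100 * (K.card : ℝ) * ε) ∧
      ((bohrSet K ρ).card : ℝ) * (1 - 100 * (K.card : ℝ) * ε)
        ≤ ((bohrSet K (ρ * (1 - ε))).card : ℝ)

/-- `0` if the Bohr set `B(K, ρ)` is regular, and its rank `|K|` otherwise. -/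
def irregularRank {G : Type*} [AddCommGroup G] [Fintype G]
    (K : Finset (AddChar G ℂ)) (ρ : ℝ) : ℝ :=
  open Classical in if IsRegularBohr K ρ then 0 else (K.card : ℝ)

/-- The VC-dimension of `A ⊆ G`: that of its family of translates `{g + A : g ∈ G}`. -/
def translateVCDim {G : Type*} [AddCommGroup G] [Fintype G] [DecidableEq G]
    (A : Finset G) : ℕ :=
  (Finset.univ.image fun g : G => g +ᵥ A).vcDim

/-- The characteristic measure `μ_A(x) = 1_A(x) |G| / |A|`. -/
def charMeasure {G : Type*} [Fintype G] (A : Finset G) : G → ℂ :=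
  (A : Set G).indicator fun _ => (Fintype.card G : ℂ) / (A.card : ℂ)

/-- The indicator function `1_A`. -/
def indicatorFn {G : Type*} (A : Finset G) : G → ℂ :=
  (A : Set G).indicator fun _ => 1

/-- The normalised convolution `f * g (x) = 𝔼_y f(y) g(x - y)`. -/
def normConv {G : Type*} [AddCommGroup G] [Fintype G] (f g : G → ℂ) (x : G) : ℂ :=
  Finset.univ.expect fun y : G => f y * g (x - y)

end

/-!
Write `f x = |A ∩ (x + A)| / |A|` (`selfOverlap`), which is the convolution `μ_A * 1_{-A}`. Its
Fourier coefficients are non-negative with sum `1`, so it is nearly invariant under `t` as soon as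
`t` is nearly annihilated by the characters that carry `f`. Such characters are found in three
steps.

*Sampling.* The value `f x` is the probability that a random point of `A` lies in `x + A`. As the
translates of `A` have VC-dimension at most `d`, a random `n`-tuple from `A` with `n ≫ d / δ²`
estimates all values of `f` to within `δ` (`card_good_tuples`). No logarithmic factor may be lost
here, since the statement allows only `log (2 / η) ^ 2`; hence symmetrization is combined with
chaining (`sum_abs_signs_le`) along nets whose size is bounded by Dudley's packing lemma
(`card_le_of_separated`). The pigeonhole argument of Croot and Sisask then gives a set `T ⊆ S` with
`|T| ≥ |S| / (2 Cⁿ)` such that every element of `T - T` is an almost period of `f`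
(`exists_almost_periods`).

*Chang's theorem.* Inside a regular Bohr set of rank `r` the characters with mean at least `1 / 2`
on `T` are, up to characters nearly constant on a smaller Bohr set, combinations with coefficients
in `{-1, 0, 1}` of `O(log (|B| / |T|))` of them (`exists_annihilating_frequencies`). The proof takes
a maximal set dissociated relative to a narrow Bohr set `Z`, and compares exponential moments over
`T` with a Riesz product averaged over `Y + l Z`, where all nontrivial coefficients are damped by
`3⁻ˡ`.

*Averaging.* Averaging `f` over `T - T` repeatedly, `L ≈ log (8 / η)` times, changes it by at most
`L` times the error of one almost period, and multiplies each Fourier coefficient outside the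
spectrum of `T` by at most `4⁻ᴸ` (`abs_selfOverlap_sub_le`). So `δ ≈ η / L` suffices, which is the
origin of `log (2 / η) ^ 2`.

Regular widths exist at every scale (`exists_isRegularBohr`). When `B(K, ρ)` is not regular,
a piece of `S` is moved into a regular Bohr set of smaller width at the cost of a factor `8 ^ |K|`
in density (`exists_regular_relative_subset`).
-/

/-! ### Traces of set families and the packing bound -/

open Finset in
/-- The trace of a set family along a map `y`: the family of preimages of its members. When `y`
lists sample points, this is the family of index sets cut out by the members. -/
def traceFamily {ι α : Type*} [Fintype ι] [DecidableEq ι] [DecidableEq α] (y : ι → α)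
    (𝓕 : Finset (Finset α)) : Finset (Finset ι) :=
  𝓕.image fun F => univ.filter fun i => y i ∈ F

open Finset in
theorem vcDim_traceFamily_le {ι α : Type*} [Fintype ι] [DecidableEq ι] [DecidableEq α]
    (y : ι → α) (𝓕 : Finset (Finset α)) : (traceFamily y 𝓕).vcDim ≤ 𝓕.vcDim := by
  refine Finset.sup_le fun s hs => ?_
  have hs : (traceFamily y 𝓕).Shatters s := by simpa using hs
  have key : ∀ t ⊆ s, ∃ F ∈ 𝓕, ∀ i ∈ s, y i ∈ F ↔ i ∈ t := by
    intro t ht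
    obtain ⟨u, hu, hut⟩ := hs ht
    obtain ⟨F, hF, rfl⟩ := Finset.mem_image.1 hu
    refine ⟨F, hF, fun i hi => ?_⟩
    rw [← hut]
    simp [hi]
  have hinj : Set.InjOn y s := by
    intro i hi j hj hij
    obtain ⟨F, -, h⟩ := key {i} (by simpa using hi)
    have h1 : y i ∈ F := (h i hi).2 (by simp)
    rw [hij] at h1
    simpa [eq_comm] using (h j hj).1 h1
  rw [← Finset.card_image_of_injOn hinj]
  refine Shatters.card_le_vcDim fun t ht => ?_
  obtain ⟨F, hF, h⟩ := key (s.filter fun i => y i ∈ t) (filter_subset _ _)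
  refine ⟨F, hF, ?_⟩
  ext z
  constructor
  · intro hz
    obtain ⟨hz1, hz2⟩ := mem_inter.1 hz
    obtain ⟨i, hi, rfl⟩ := mem_image.1 hz1
    exact (mem_filter.1 ((h i hi).1 hz2)).2
  · intro hz
    obtain ⟨i, hi, rfl⟩ := mem_image.1 (ht hz)
    exact mem_inter.2 ⟨ht hz, (h i hi).2 (mem_filter.2 ⟨hi, hz⟩)⟩

open Finset in
/-- Sauer–Shelah in exponential form. The free parameter `x` absorbs the usual case distinction
between `m ≤ d` and `m > d`. -/
theorem card_le_of_vcDim_le {ι : Type*} [Fintype ι] [DecidableEq ι] (𝓕 : Finset (Finset ι))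
    {d : ℕ} (hd : 𝓕.vcDim ≤ d) {x : ℝ} (hx : 0 < x) (hx1 : x ≤ 1) :
    (𝓕.card : ℝ) ≤ (1 / x) ^ d * Real.exp (x * Fintype.card ι) := by
  set m := Fintype.card ι
  have h1 : 𝓕.card ≤ ∑ i ∈ Iic d, m.choose i :=
    (card_le_card_shatterer 𝓕).trans <| card_shatterer_le_sum_vcDim.trans <|
      sum_le_sum_of_subset (Iic_subset_Iic.2 hd)
  have h2 : (𝓕.card : ℝ) ≤ ∑ i ∈ Iic d, (m.choose i : ℝ) := by exact_mod_cast h1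
  have h3 : ∑ i ∈ Iic d, (m.choose i : ℝ) ≤ ∑ i ∈ Iic d, (1 / x) ^ d * (x ^ i * m.choose i) := by
    refine sum_le_sum fun i hi => ?_
    rw [← mul_assoc]
    refine le_mul_of_one_le_left (by positivity) ?_
    have hi : i ≤ d := by simpa using hi
    rw [one_div, inv_pow, ← div_eq_inv_mul, one_le_div (by positivity)]
    exact pow_le_pow_of_le_one hx.le hx1 hi
  have h4 : ∑ i ∈ Iic d, x ^ i * (m.choose i : ℝ) ≤ (x + 1) ^ m := by
    have : (x + 1) ^ m = ∑ i ∈ range (m + 1), x ^ i * (m.choose i : ℝ) := by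
      rw [add_pow]; simp
    rw [this]
    have : ∑ i ∈ Iic d, x ^ i * (m.choose i : ℝ)
        = ∑ i ∈ (Iic d).filter (fun i => i ≤ m), x ^ i * (m.choose i : ℝ) := by
      rw [sum_filter]
      refine sum_congr rfl fun i _ => ?_
      split_ifs with h
      · rfl
      · rw [Nat.choose_eq_zero_of_lt (not_le.1 h)]; simp
    rw [this]
    refine sum_le_sum_of_subset_of_nonneg (fun i hi => ?_) fun _ _ _ => by positivity
    simp only [mem_filter, mem_range] at hi ⊢
    omega
  have h5 : (x + 1) ^ m ≤ Real.exp (x * m) := by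
    rw [mul_comm, Real.exp_nat_mul]
    exact pow_le_pow_left₀ (by positivity) (Real.add_one_le_exp x) _
  calc (𝓕.card : ℝ) ≤ (1 / x) ^ d * ∑ i ∈ Iic d, x ^ i * (m.choose i : ℝ) := by
        rw [mul_sum]; exact h2.trans h3
    _ ≤ _ := by gcongr; exact h4.trans h5

open Finset in
/-- If all differences of members of `𝓝` are large, some `m`-tuple of points meets all of them:
a random tuple misses a given one with probability at most `exp (-δ m)`. -/
theorem exists_injOn_trace {β : Type*} [Fintype β] [DecidableEq β] [Nonempty β]
    (𝓝 : Finset (Finset β)) {δ : ℝ} (m : ℕ)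
    (hsep : ∀ P ∈ 𝓝, ∀ Q ∈ 𝓝, P ≠ Q → δ * Fintype.card β < (symmDiff P Q).card)
    (hm : (𝓝.card : ℝ) ^ 2 * Real.exp (-(δ * m)) < 1) :
    ∃ y : Fin m → β,
      Set.InjOn (fun F : Finset β => univ.filter fun i => y i ∈ F) (𝓝 : Set (Finset β)) := by
  by_contra! hcon
  have hcov : (univ : Finset (Fin m → β)) ⊆
      𝓝.offDiag.biUnion fun p => Fintype.piFinset fun _ => (symmDiff p.1 p.2)ᶜ := by
    intro y _
    have := hcon y
    rw [Set.InjOn] at this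
    push Not at this
    obtain ⟨P, hP, Q, hQ, hPQ, hne⟩ := this
    refine mem_biUnion.2 ⟨(P, Q), mem_offDiag.2 ⟨hP, hQ, hne⟩, ?_⟩
    refine Fintype.mem_piFinset.2 fun i => ?_
    have hi : y i ∈ P ↔ y i ∈ Q := by simpa using Finset.ext_iff.1 hPQ i
    simp only [mem_compl, mem_symmDiff]
    tauto
  have hk : (0 : ℝ) < Fintype.card β := by exact_mod_cast Fintype.card_pos
  have h1 : ((Fintype.card β : ℝ)) ^ m ≤
      ∑ p ∈ 𝓝.offDiag, (Fintype.card β : ℝ) ^ m * Real.exp (-(δ * m)) := by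
    have h2 := (card_le_card hcov).trans card_biUnion_le
    rw [card_univ, Fintype.card_fun, Fintype.card_fin] at h2
    have h3 : ((Fintype.card β : ℝ)) ^ m ≤ ∑ p ∈ 𝓝.offDiag,
        ((Fintype.piFinset fun _ : Fin m => (symmDiff p.1 p.2)ᶜ).card : ℝ) := by
      exact_mod_cast h2
    refine h3.trans (sum_le_sum fun p hp => ?_)
    obtain ⟨hP, hQ, hne⟩ := mem_offDiag.1 hp
    rw [Fintype.card_piFinset_const]
    push_cast [card_compl, Nat.cast_sub (card_le_univ (symmDiff p.1 p.2))]
    have h4 := hsep _ hP _ hQ hne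
    have h5 : (Fintype.card β : ℝ) - (symmDiff p.1 p.2).card
        ≤ Fintype.card β * Real.exp (-δ) := by
      have := Real.add_one_le_exp (-δ)
      nlinarith
    have h6 : (0 : ℝ) ≤ (Fintype.card β : ℝ) - (symmDiff p.1 p.2).card := by
      have := card_le_univ (symmDiff p.1 p.2)
      rw [sub_nonneg]; exact_mod_cast this
    calc _ ≤ (Fintype.card β * Real.exp (-δ)) ^ m := pow_le_pow_left₀ h6 h5 m
      _ = _ := by
        rw [mul_pow, ← Real.exp_nat_mul]
        congr 2; ring
  rw [sum_const, nsmul_eq_mul] at h1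
  have h7 : (𝓝.offDiag.card : ℝ) ≤ (𝓝.card : ℝ) ^ 2 := by
    rw [offDiag_card, sq]
    exact_mod_cast Nat.sub_le _ _
  have h8 : (𝓝.offDiag.card : ℝ) * ((Fintype.card β : ℝ) ^ m * Real.exp (-(δ * m)))
      ≤ (Fintype.card β : ℝ) ^ m * ((𝓝.card : ℝ) ^ 2 * Real.exp (-(δ * m))) := by
    rw [mul_left_comm]; gcongr
  have h9 : (0 : ℝ) < (Fintype.card β : ℝ) ^ m := by positivity
  nlinarith

open Finset in
/-- Dudley's packing bound for a separated family of bounded VC-dimension. It follows from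
Sauer–Shelah on a random set of points that separates all members. -/
theorem card_le_of_separated {β : Type*} [Fintype β] [DecidableEq β]
    (𝓝 : Finset (Finset β)) {d : ℕ} (hd : 𝓝.vcDim ≤ d) {δ : ℝ} (hδ : 0 < δ) (hδ1 : δ ≤ 1)
    (hsep : ∀ P ∈ 𝓝, ∀ Q ∈ 𝓝, P ≠ Q → δ * Fintype.card β < (symmDiff P Q).card) :
    (𝓝.card : ℝ) ≤ 2 * (4 / δ) ^ (2 * d) := by
  have hbase : (1 : ℝ) ≤ 4 / δ := by rw [le_div_iff₀ hδ]; linarith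
  have hpow : (1 : ℝ) ≤ (4 / δ) ^ (2 * d) := one_le_pow₀ hbase
  rcases le_or_gt 𝓝.card 1 with h1 | h1
  · have : (𝓝.card : ℝ) ≤ 1 := by exact_mod_cast h1
    linarith
  obtain ⟨P, hP, Q, hQ, hne⟩ := one_lt_card.1 h1
  have hβ : Nonempty β := by
    by_contra h
    rw [not_nonempty_iff] at h
    exact hne (Subsingleton.elim _ _)
  set M : ℝ := (𝓝.card : ℝ) with hM
  have hM1 : 1 < M := by rw [hM]; exact_mod_cast h1
  set m := ⌊2 * Real.log M / δ⌋₊ + 1 with hm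
  have hlog : 0 < Real.log M := Real.log_pos hM1
  have hm1 : 2 * Real.log M / δ < m := by rw [hm]; push_cast; exact Nat.lt_floor_add_one _
  have hm2 : (m : ℝ) ≤ 2 * Real.log M / δ + 1 := by
    rw [hm]; push_cast
    gcongr
    exact Nat.floor_le (by positivity)
  rw [div_lt_iff₀ hδ] at hm1
  obtain ⟨y, hy⟩ := exists_injOn_trace 𝓝 m hsep (by
    have : M ^ 2 = Real.exp (2 * Real.log M) := by
      rw [mul_comm, Real.exp_mul, Real.exp_log (by linarith)]; norm_cast
    rw [this, ← Real.exp_add, Real.exp_lt_one_iff]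
    linarith)
  have hcard : (traceFamily y 𝓝).card = 𝓝.card := card_image_of_injOn hy
  have hS := card_le_of_vcDim_le (traceFamily y 𝓝) ((vcDim_traceFamily_le y 𝓝).trans hd)
    (x := δ / 4) (by positivity) (by linarith)
  rw [hcard, Fintype.card_fin, ← hM] at hS
  have hexp : Real.exp (δ / 4 * m) ≤ Real.exp (1 / 4) * √M := by
    have : √M = Real.exp (Real.log M / 2) := by
      rw [Real.sqrt_eq_rpow, Real.rpow_def_of_pos (by linarith)]; congr 1; ring
    rw [this, ← Real.exp_add]
    refine Real.exp_le_exp.2 ?_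
    have : δ / 4 * m ≤ δ / 4 * (2 * Real.log M / δ + 1) := by gcongr
    have h2 : δ / 4 * (2 * Real.log M / δ + 1) = Real.log M / 2 + δ / 4 := by
      field_simp; ring
    linarith
  have hsq : √M * √M = M := Real.mul_self_sqrt (by linarith)
  have hsq0 : 0 < √M := Real.sqrt_pos.2 (by linarith)
  have h3 : √M ≤ (4 / δ) ^ d * Real.exp (1 / 4) := by
    have h4 : √M * √M ≤ ((4 / δ) ^ d * Real.exp (1 / 4)) * √M := by
      rw [hsq]
      refine hS.trans ?_
      rw [one_div_div, mul_assoc]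
      gcongr
    exact le_of_mul_le_mul_right h4 hsq0
  have h5 : M ≤ ((4 / δ) ^ d * Real.exp (1 / 4)) ^ 2 := by
    rw [← hsq, ← sq]; gcongr
  refine h5.trans ?_
  rw [mul_pow, ← pow_mul, mul_comm d 2, mul_comm (2 : ℝ)]
  gcongr
  rw [← Real.exp_nat_mul]
  have : Real.exp ((2 : ℕ) * (1 / 4)) ^ 2 ≤ 2 ^ 2 := by
    rw [← Real.exp_nat_mul]
    norm_num
    exact Real.exp_one_lt_d9.le.trans (by norm_num)
  exact le_of_sq_le_sq this (by norm_num)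

open Finset in
/-- A maximal separated subfamily is a net; its size is controlled by `card_le_of_separated`. -/
theorem exists_net {β : Type*} [Fintype β] [DecidableEq β]
    (𝓕 : Finset (Finset β)) {d : ℕ} (hd : 𝓕.vcDim ≤ d) {δ : ℝ} (hδ : 0 < δ) (hδ1 : δ ≤ 1) :
    ∃ 𝓝 : Finset (Finset β), (𝓝.card : ℝ) ≤ 2 * (4 / δ) ^ (2 * d) ∧
      ∀ F ∈ 𝓕, ∃ P ∈ 𝓝, ((symmDiff F P).card : ℝ) ≤ δ * Fintype.card β := by
  classical
  obtain ⟨𝓝, h𝓝, hmax⟩ := exists_max_image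
    (𝓕.powerset.filter fun 𝓝 => ∀ P ∈ 𝓝, ∀ Q ∈ 𝓝, P ≠ Q →
      δ * Fintype.card β < (symmDiff P Q).card) card ⟨∅, by simp⟩
  rw [mem_filter, mem_powerset] at h𝓝
  refine ⟨𝓝, card_le_of_separated 𝓝 ((vcDim_mono h𝓝.1).trans hd) hδ hδ1 h𝓝.2,
    fun F hF => ?_⟩
  by_contra! hcon
  have hF𝓝 : F ∉ 𝓝 := fun h => by
    have := hcon F h
    rw [symmDiff_self] at this
    simp only [bot_eq_empty, card_empty, Nat.cast_zero] at this
    have : 0 ≤ δ * Fintype.card β := by positivity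
    linarith
  have := hmax (insert F 𝓝) (by
    rw [mem_filter, mem_powerset]
    refine ⟨insert_subset hF h𝓝.1, ?_⟩
    intro P hP Q hQ hne
    rcases mem_insert.1 hP with rfl | hP' <;> rcases mem_insert.1 hQ with rfl | hQ'
    · exact absurd rfl hne
    · exact hcon Q hQ'
    · rw [symmDiff_comm]; exact hcon P hP'
    · exact h𝓝.2 P hP' Q hQ' hne)
  rw [card_insert_of_notMem hF𝓝] at this
  omega

/-! ### Rademacher averages and chaining -/

/-- The sign `±1` encoded by a Boolean. -/
def boolSign (b : Bool) : ℝ := if b then 1 else -1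

theorem sum_exp_signs_le {ι : Type*} [Fintype ι] [DecidableEq ι] (c : ι → ℝ) :
    ∑ ε : ι → Bool, Real.exp (∑ i, boolSign (ε i) * c i)
      ≤ 2 ^ Fintype.card ι * Real.exp ((∑ i, c i ^ 2) / 2) := by
  have h : ∑ ε : ι → Bool, Real.exp (∑ i, boolSign (ε i) * c i)
      = ∏ i, ∑ b : Bool, Real.exp (boolSign b * c i) := by
    rw [Fintype.prod_sum]
    exact Finset.sum_congr rfl fun ε _ => Real.exp_sum _ _
  rw [h, Finset.sum_div, Real.exp_sum]
  have : (2 : ℝ) ^ Fintype.card ι * ∏ i, Real.exp (c i ^ 2 / 2)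
      = ∏ i, 2 * Real.exp (c i ^ 2 / 2) := by
    rw [Finset.prod_mul_distrib]; simp
  rw [this]
  refine Finset.prod_le_prod (fun i _ => by positivity) fun i _ => ?_
  have := Real.cosh_le_exp_half_sq (c i)
  rw [Real.cosh_eq] at this
  simp only [Fintype.sum_bool, boolSign, if_true, one_mul, Bool.false_eq_true, if_false, neg_mul]
  linarith

/-- Maximal inequality for finitely many Rademacher sums, with the parameter `lam` of the moment
generating function left free. -/
theorem sum_max_signs_le {ι τ : Type*} [Fintype ι] [DecidableEq ι] (s : Finset τ)
    (c : τ → ι → ℝ) {v lam : ℝ} (hv : ∀ t ∈ s, ∑ i, c t i ^ 2 ≤ v) (hlam : 0 < lam)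
    (M : (ι → Bool) → ℝ) (hM : ∀ ε, ∃ t ∈ s, M ε ≤ |∑ i, boolSign (ε i) * c t i|) :
    ∑ ε, M ε ≤ 2 ^ Fintype.card ι * (Real.log (2 * s.card) / lam + lam * v / 2) := by
  have hs : 0 < (s.card : ℝ) := by
    obtain ⟨t, ht, -⟩ := hM fun _ => true
    exact_mod_cast Finset.card_pos.2 ⟨t, ht⟩
  set L := Real.log (2 * s.card) + lam ^ 2 * v / 2 with hL
  have hexpL : Real.exp L = 2 * s.card * Real.exp (lam ^ 2 * v / 2) := by
    rw [hL, Real.exp_add, Real.exp_log (by positivity)]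
  have hone : ∀ (a : ℝ), a ^ 2 = 1 → ∀ t ∈ s,
      ∑ ε : ι → Bool, Real.exp (a * lam * ∑ i, boolSign (ε i) * c t i)
      ≤ 2 ^ Fintype.card ι * Real.exp (lam ^ 2 * v / 2) := by
    intro a ha t ht
    have h := sum_exp_signs_le fun i => a * lam * c t i
    have h2 : ∑ i, (a * lam * c t i) ^ 2 = lam ^ 2 * ∑ i, c t i ^ 2 := by
      rw [Finset.mul_sum]
      refine Finset.sum_congr rfl fun i _ => ?_
      rw [mul_pow, mul_pow, ha, one_mul]
    rw [h2] at h
    calc _ = ∑ ε : ι → Bool, Real.exp (∑ i, boolSign (ε i) * (a * lam * c t i)) := by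
          refine Finset.sum_congr rfl fun ε _ => ?_
          rw [Finset.mul_sum]
          congr 1
          refine Finset.sum_congr rfl fun i _ => ?_
          ring
      _ ≤ _ := h
      _ ≤ _ := by gcongr; exact hv t ht
  have hpt : ∀ ε : ι → Bool, Real.exp (lam * M ε) ≤
      ∑ t ∈ s, (Real.exp (1 * lam * ∑ i, boolSign (ε i) * c t i)
        + Real.exp ((-1) * lam * ∑ i, boolSign (ε i) * c t i)) := by
    intro ε
    obtain ⟨t, ht, h⟩ := hM ε
    refine le_trans ?_ (Finset.single_le_sum
      (f := fun t => Real.exp (1 * lam * ∑ i, boolSign (ε i) * c t i)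
        + Real.exp ((-1) * lam * ∑ i, boolSign (ε i) * c t i)) (fun _ _ => by positivity) ht)
    rcases abs_cases (∑ i, boolSign (ε i) * c t i) with ⟨h1, -⟩ | ⟨h1, -⟩ <;> rw [h1] at h
    · refine le_add_of_le_of_nonneg (Real.exp_le_exp.2 ?_) (by positivity)
      rw [one_mul]; gcongr
    · refine le_add_of_nonneg_of_le (by positivity) (Real.exp_le_exp.2 ?_)
      have : lam * M ε ≤ lam * -∑ i, boolSign (ε i) * c t i := by gcongr
      linarith
  have hsum : ∑ ε, Real.exp (lam * M ε) ≤ 2 ^ Fintype.card ι * Real.exp L := by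
    refine (Finset.sum_le_sum fun ε _ => hpt ε).trans ?_
    rw [Finset.sum_comm]
    refine (Finset.sum_le_card_nsmul s _ (2 * (2 ^ Fintype.card ι * Real.exp (lam ^ 2 * v / 2)))
      fun t ht => ?_).trans_eq ?_
    · rw [Finset.sum_add_distrib, two_mul]
      exact add_le_add (hone 1 (by norm_num) t ht) (hone (-1) (by norm_num) t ht)
    · rw [nsmul_eq_mul, hexpL]; ring
  -- the tangent of the exponential at `0` turns the exponential moment into a first moment
  have htan : ∀ ε : ι → Bool, lam * M ε ≤ L - 1 + Real.exp (lam * M ε) * Real.exp (-L) := by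
    intro ε
    rw [← Real.exp_add]
    have := Real.add_one_le_exp (lam * M ε + -L)
    linarith
  have hfin : lam * ∑ ε, M ε ≤ 2 ^ Fintype.card ι * L := by
    rw [Finset.mul_sum]
    refine (Finset.sum_le_sum fun ε _ => htan ε).trans ?_
    rw [Finset.sum_add_distrib, ← Finset.sum_mul]
    have h1 : (∑ ε, Real.exp (lam * M ε)) * Real.exp (-L) ≤ 2 ^ Fintype.card ι := by
      rw [Real.exp_neg, ← div_eq_mul_inv, div_le_iff₀ (Real.exp_pos L)]
      exact hsum
    simp only [Finset.sum_const, Finset.card_univ, Fintype.card_fun, Fintype.card_bool,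
      nsmul_eq_mul, Nat.cast_pow, Nat.cast_ofNat]
    linarith
  have : ∑ ε, M ε ≤ 2 ^ Fintype.card ι * L / lam := by
    rw [le_div_iff₀ hlam]; linarith
  refine this.trans_eq ?_
  rw [hL]
  field_simp

open Finset in
/-- One link of the chain: the increments between the nets at scales `4⁻ʲ` and `4⁻⁽ʲ⁺¹⁾`. -/
theorem sum_chain_link_le {n d : ℕ} (hd : 1 ≤ d) (hn : 1 ≤ n) (j : ℕ)
    (𝓟 𝓠 : Finset (Finset (Fin n)))
    (h𝓟 : (𝓟.card : ℝ) ≤ 2 * (4 * 4 ^ (j + 1)) ^ (2 * d))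
    (h𝓠 : (𝓠.card : ℝ) ≤ 2 * (4 * 4 ^ j) ^ (2 * d))
    (P Q : (Fin n → Bool) → Finset (Fin n)) (hP : ∀ ε, P ε ∈ 𝓟) (hQ : ∀ ε, Q ε ∈ 𝓠)
    (hPQ : ∀ ε, ((symmDiff (P ε) (Q ε)).card : ℝ) ≤ 2 * n / 4 ^ j) :
    ∑ ε : Fin n → Bool, |∑ i ∈ P ε, boolSign (ε i) - ∑ i ∈ Q ε, boolSign (ε i)|
      ≤ 2 ^ n * (√(d * n) * (12 * (j + 1) / 2 ^ j)) := by
  classical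
  set s := (𝓟 ×ˢ 𝓠).filter fun p => ((symmDiff p.1 p.2).card : ℝ) ≤ 2 * n / 4 ^ j with hs
  set c : Finset (Fin n) × Finset (Fin n) → Fin n → ℝ :=
    fun p i => (if i ∈ p.1 then 1 else 0) - (if i ∈ p.2 then 1 else 0) with hc
  have hmem : ∀ ε, (P ε, Q ε) ∈ s := fun ε => by
    rw [hs, mem_filter, mem_product]; exact ⟨⟨hP ε, hQ ε⟩, hPQ ε⟩
  have hd0 : (1 : ℝ) ≤ d := by exact_mod_cast hd
  have hn0 : (1 : ℝ) ≤ n := by exact_mod_cast hn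
  have hlam : 0 < √(d / n) * 2 ^ j := by positivity
  have hv : ∀ p ∈ s, ∑ i, c p i ^ 2 ≤ 2 * n / 4 ^ j := by
    intro p hp
    refine le_trans (le_of_eq ?_) (mem_filter.1 hp).2
    rw [card_eq_sum_ones, Nat.cast_sum, ← sum_filter_add_sum_filter_not univ
      (fun i => i ∈ symmDiff p.1 p.2)]
    rw [filter_mem_eq_inter, univ_inter]
    rw [sum_eq_zero (s := univ.filter fun i => i ∉ symmDiff p.1 p.2), add_zero]
    · refine sum_congr rfl fun i hi => ?_
      rcases mem_symmDiff.1 hi with ⟨h1, h2⟩ | ⟨h1, h2⟩ <;> simp [hc, h1, h2]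
    · intro i hi
      have : i ∈ p.1 ↔ i ∈ p.2 := by
        have := (mem_filter.1 hi).2
        rw [mem_symmDiff] at this
        tauto
      simp [hc, this]
  have hmain := sum_max_signs_le s c hv hlam
    (fun ε => |∑ i ∈ P ε, boolSign (ε i) - ∑ i ∈ Q ε, boolSign (ε i)|)
    (fun ε => ⟨_, hmem ε, le_of_eq ?_⟩)
  swap
  · congr 1
    simp [hc, mul_sub, sum_sub_distrib]
  rw [Fintype.card_fin] at hmain
  refine hmain.trans ?_
  gcongr
  -- both terms are multiples of `√(d n) / 2 ^ j`
  have hspos : 0 < (s.card : ℝ) := by exact_mod_cast card_pos.2 ⟨_, hmem fun _ => true⟩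
  have hscard : (2 * s.card : ℝ) ≤ 8 * (4 * 4 ^ (j + 1)) ^ (2 * d) * (4 * 4 ^ j) ^ (2 * d) := by
    have h1 : (s.card : ℝ) ≤ 𝓟.card * 𝓠.card := by
      rw [← Nat.cast_mul, ← card_product]
      exact_mod_cast card_filter_le _ _
    have h2 : (𝓟.card : ℝ) * 𝓠.card
        ≤ (2 * (4 * 4 ^ (j + 1)) ^ (2 * d)) * (2 * (4 * 4 ^ j) ^ (2 * d)) := by gcongr
    linarith
  have hlog : Real.log (2 * s.card) ≤ 11 * d * (j + 1) := by
    have h1 : (8 : ℝ) * (4 * 4 ^ (j + 1)) ^ (2 * d) * (4 * 4 ^ j) ^ (2 * d)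
        = 2 ^ (3 + (2 * (j + 2) + 2 * (j + 1)) * (2 * d)) := by
      have h4 : (4 : ℝ) = 2 ^ 2 := by norm_num
      have h8 : (8 : ℝ) = 2 ^ 3 := by norm_num
      rw [h4, h8]
      simp only [← pow_mul, ← pow_add]
      congr 1; ring
    refine (Real.log_le_log (by positivity) (hscard.trans_eq h1)).trans ?_
    rw [Real.log_pow]
    have h2 := Real.log_two_lt_d9
    have h3 : ((3 + (2 * (j + 2) + 2 * (j + 1)) * (2 * d) : ℕ) : ℝ) ≤ 15 * d * (j + 1) := by
      push_cast
      have : (0 : ℝ) ≤ j * d := by positivity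
      nlinarith
    have h4 : (0 : ℝ) ≤ d * (j + 1) := by positivity
    calc _ ≤ 15 * d * (j + 1) * Real.log 2 := by gcongr
      _ ≤ _ := by nlinarith
  have hsd : √((d : ℝ) / n) * n = √(d * n) := by
    rw [Real.sqrt_div (by positivity), Real.sqrt_mul (by positivity), div_mul_eq_mul_div,
      div_eq_iff (by positivity), mul_assoc, Real.mul_self_sqrt (by positivity)]
  have hsd2 : (d : ℝ) / √((d : ℝ) / n) = √(d * n) := by
    rw [Real.sqrt_div (by positivity), Real.sqrt_mul (by positivity), div_div_eq_mul_div,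
      div_eq_iff (by positivity), mul_right_comm, Real.mul_self_sqrt (by positivity)]
  have h4 : (4 : ℝ) ^ j = 2 ^ j * 2 ^ j := by rw [← mul_pow]; norm_num
  calc Real.log (2 * s.card) / (√(d / n) * 2 ^ j) + √(d / n) * 2 ^ j * (2 * n / 4 ^ j) / 2
      ≤ 11 * d * (j + 1) / (√(d / n) * 2 ^ j) + √(d / n) * 2 ^ j * (2 * n / 4 ^ j) / 2 := by
        gcongr
    _ = 11 * (j + 1) / 2 ^ j * (d / √(d / n)) + √(d / n) * n / 2 ^ j := by
        rw [h4]; field_simp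
    _ = √(d * n) * ((11 * (j + 1) + 1) / 2 ^ j) := by
        rw [hsd, hsd2]; ring
    _ ≤ √(d * n) * (12 * (j + 1) / 2 ^ j) := by
        gcongr
        have : (0 : ℝ) ≤ j := by positivity
        linarith

theorem sum_succ_div_two_pow_le (J : ℕ) :
    ∑ j ∈ Finset.range J, (12 * ((j : ℝ) + 1) / 2 ^ j) ≤ 48 := by
  have h : ∀ J : ℕ, ∑ j ∈ Finset.range J, (12 * ((j : ℝ) + 1) / 2 ^ j)
      = 48 - 24 * (J + 2) / 2 ^ J := by
    intro J
    induction J with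
    | zero => norm_num
    | succ J ih =>
      rw [Finset.sum_range_succ, ih, pow_succ]
      push_cast
      field_simp
      ring
  rw [h J]
  have : (0 : ℝ) ≤ 24 * (J + 2) / 2 ^ J := by positivity
  linarith

open Finset in
/-- The Rademacher average of a set family of VC-dimension `d` on `n` points is `O(√(d n))`,
without a logarithmic factor: this is chaining along nets at the scales `4⁻ʲ`, starting from the
empty set. The function `F` selects a member of the family for every choice of signs. -/
theorem sum_abs_signs_le {n d : ℕ} (hd : 1 ≤ d) (𝓕 : Finset (Finset (Fin n)))
    (h𝓕 : 𝓕.vcDim ≤ d) (F : (Fin n → Bool) → Finset (Fin n)) (hF : ∀ ε, F ε ∈ 𝓕) :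
    ∑ ε : Fin n → Bool, |∑ i ∈ F ε, boolSign (ε i)| ≤ 2 ^ n * (48 * √(d * n)) := by
  classical
  rcases Nat.eq_zero_or_pos n with rfl | hn
  · simp [Subsingleton.elim _ (∅ : Finset (Fin 0))]
  have hnets : ∀ j : ℕ, ∃ 𝓝 : Finset (Finset (Fin n)),
      (𝓝.card : ℝ) ≤ 2 * (4 * 4 ^ j) ^ (2 * d) ∧ (j = 0 → 𝓝 = {∅}) ∧
      ∀ F ∈ 𝓕, ∃ P ∈ 𝓝, ((symmDiff F P).card : ℝ) ≤ n / 4 ^ j := by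
    intro j
    rcases Nat.eq_zero_or_pos j with rfl | hj
    · refine ⟨{∅}, ?_, fun _ => rfl, fun F _ => ⟨∅, by simp, ?_⟩⟩
      · have : (1 : ℝ) ≤ (4 * 4 ^ 0) ^ (2 * d) := one_le_pow₀ (by norm_num)
        rw [card_singleton]; push_cast; linarith
      · rw [pow_zero, div_one]
        exact_mod_cast (card_le_univ _).trans_eq (Fintype.card_fin n)
    · obtain ⟨𝓝, h1, h2⟩ := exists_net 𝓕 h𝓕 (δ := 1 / 4 ^ j) (by positivity)
        (by rw [div_le_one (by positivity)]; exact one_le_pow₀ (by norm_num))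
      refine ⟨𝓝, by simpa using h1, fun h => by omega, fun F hF => ?_⟩
      obtain ⟨P, hP, h⟩ := h2 F hF
      refine ⟨P, hP, h.trans_eq ?_⟩
      rw [Fintype.card_fin]; ring
  choose 𝓝 h𝓝card h𝓝0 h𝓝 using hnets
  choose! π hπmem hπ using h𝓝
  have hlast : ∀ ε, π n (F ε) = F ε := by
    intro ε
    have h := hπ n (F ε) (hF ε)
    have h1 : (n : ℝ) / 4 ^ n < 1 := by
      rw [div_lt_one (by positivity)]
      exact_mod_cast Nat.lt_pow_self (by norm_num)
    have h2 : (symmDiff (F ε) (π n (F ε))).card = 0 := by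
      have : ((symmDiff (F ε) (π n (F ε))).card : ℝ) < 1 := h.trans_lt h1
      exact_mod_cast Nat.lt_one_iff.1 (by exact_mod_cast this)
    rw [card_eq_zero, ← bot_eq_empty, symmDiff_eq_bot] at h2
    exact h2.symm
  have hfirst : ∀ ε, π 0 (F ε) = ∅ := by
    intro ε
    have := hπmem 0 (F ε) (hF ε)
    rw [h𝓝0 0 rfl] at this
    simpa using this
  have hlink : ∀ j, ∑ ε : Fin n → Bool, |∑ i ∈ π (j + 1) (F ε), boolSign (ε i)
      - ∑ i ∈ π j (F ε), boolSign (ε i)| ≤ 2 ^ n * (√(d * n) * (12 * (j + 1) / 2 ^ j)) := by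
    intro j
    refine sum_chain_link_le hd hn j (𝓝 (j + 1)) (𝓝 j) (h𝓝card _) (h𝓝card _) _ _
      (fun ε => hπmem _ _ (hF ε)) (fun ε => hπmem _ _ (hF ε)) fun ε => ?_
    have h1 := hπ (j + 1) (F ε) (hF ε)
    have h2 := hπ j (F ε) (hF ε)
    have h3 : (symmDiff (π (j + 1) (F ε)) (π j (F ε))).card
        ≤ (symmDiff (F ε) (π (j + 1) (F ε))).card + (symmDiff (F ε) (π j (F ε))).card := by
      refine (card_le_card ?_).trans (card_union_le _ _)
      rw [symmDiff_comm (F ε) (π (j + 1) (F ε))]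
      exact symmDiff_triangle _ _ _
    have h4 : (n : ℝ) / 4 ^ (j + 1) ≤ n / 4 ^ j := by
      gcongr
      · norm_num
      · omega
    have h5 : ((symmDiff (π (j + 1) (F ε)) (π j (F ε))).card : ℝ)
        ≤ (symmDiff (F ε) (π (j + 1) (F ε))).card + (symmDiff (F ε) (π j (F ε))).card := by
      exact_mod_cast h3
    calc _ ≤ (n : ℝ) / 4 ^ j + n / 4 ^ j := by linarith
      _ = _ := by ring
  have hpt : ∀ ε : Fin n → Bool, |∑ i ∈ F ε, boolSign (ε i)| ≤
      ∑ j ∈ range n, |∑ i ∈ π (j + 1) (F ε), boolSign (ε i)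
        - ∑ i ∈ π j (F ε), boolSign (ε i)| := by
    intro ε
    have h := sum_range_sub (fun j => ∑ i ∈ π j (F ε), boolSign (ε i)) n
    rw [hlast, hfirst, sum_empty, sub_zero] at h
    rw [← h]
    exact abs_sum_le_sum_abs _ _
  calc _ ≤ ∑ ε : Fin n → Bool, ∑ j ∈ range n, |∑ i ∈ π (j + 1) (F ε), boolSign (ε i)
        - ∑ i ∈ π j (F ε), boolSign (ε i)| := sum_le_sum fun ε _ => hpt ε
    _ = ∑ j ∈ range n, ∑ ε : Fin n → Bool, |∑ i ∈ π (j + 1) (F ε), boolSign (ε i)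
        - ∑ i ∈ π j (F ε), boolSign (ε i)| := sum_comm
    _ ≤ ∑ j ∈ range n, 2 ^ n * (√(d * n) * (12 * (j + 1) / 2 ^ j)) :=
        sum_le_sum fun j _ => hlink j
    _ = 2 ^ n * (√(d * n) * ∑ j ∈ range n, (12 * ((j : ℝ) + 1) / 2 ^ j)) := by
        rw [mul_sum, mul_sum]
    _ ≤ 2 ^ n * (√(d * n) * 48) := by gcongr; exact sum_succ_div_two_pow_le n
    _ = _ := by ring

/-! ### Symmetrization and sampling -/

/-- Exchanging the `i`-th coordinate with an extra one shows that it is uniformly distributed. -/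
theorem card_mul_sum_apply {Ω ι : Type*} [Fintype Ω] [Fintype ι] [DecidableEq ι]
    (h : Ω → ℝ) (i : ι) :
    (Fintype.card Ω : ℝ) * ∑ a : ι → Ω, h (a i) = Fintype.card (ι → Ω) * ∑ w, h w := by
  classical
  let e : (ι → Ω) × Ω → (ι → Ω) × Ω := fun p => (Function.update p.1 i p.2, p.1 i)
  have he : Function.Involutive e := fun p => by simp [e]
  have h1 : ∑ p : (ι → Ω) × Ω, h (p.1 i) = ∑ p : (ι → Ω) × Ω, h p.2 :=
    Fintype.sum_equiv he.toPerm _ _ fun p => rfl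
  rw [Fintype.sum_prod_type, Fintype.sum_prod_type] at h1
  simp only [Finset.sum_const, Finset.card_univ, nsmul_eq_mul] at h1
  rw [Finset.mul_sum]
  exact h1

/-- Symmetrization: the mean largest deviation of an empirical sum from its expectation is at most
twice the corresponding Rademacher average. -/
theorem sum_sup_deviation_le {Ω ι : Type*} [Fintype Ω] [Nonempty Ω] (𝓗 : Finset ι)
    (h𝓗 : 𝓗.Nonempty) (h : ι → Ω → ℝ) (n : ℕ) {R : ℝ}
    (hR : ∀ a : Fin n → Ω,
      ∑ ε : Fin n → Bool, 𝓗.sup' h𝓗 (fun j => |∑ i, boolSign (ε i) * h j (a i)|) ≤ 2 ^ n * R) :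
    ∑ a : Fin n → Ω, 𝓗.sup' h𝓗
        (fun j => |∑ i, h j (a i) - n * ((∑ w, h j w) / Fintype.card Ω)|)
      ≤ (Fintype.card Ω : ℝ) ^ n * (2 * R) := by
  classical
  set N : ℝ := (Fintype.card Ω : ℝ) with hN
  have hN0 : 0 < N := by rw [hN]; exact_mod_cast Fintype.card_pos
  have hcard : (Fintype.card (Fin n → Ω) : ℝ) = N ^ n := by simp [hN]
  set D : ℝ := ∑ a : Fin n → Ω, ∑ a' : Fin n → Ω,
    𝓗.sup' h𝓗 (fun j => |∑ i, (h j (a i) - h j (a' i))|) with hD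
  -- replacing the expectation by an independent copy of the sample
  have hcopy : N ^ n * ∑ a : Fin n → Ω, 𝓗.sup' h𝓗
      (fun j => |∑ i, h j (a i) - n * ((∑ w, h j w) / N)|) ≤ D := by
    rw [Finset.mul_sum]
    refine Finset.sum_le_sum fun a _ => ?_
    obtain ⟨j, hj, hjeq⟩ := Finset.exists_mem_eq_sup' h𝓗
      (fun j => |∑ i, h j (a i) - n * ((∑ w, h j w) / N)|)
    rw [hjeq]
    have h1 : N ^ n * (∑ i, h j (a i) - n * ((∑ w, h j w) / N))
        = ∑ a' : Fin n → Ω, ∑ i, (h j (a i) - h j (a' i)) := by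
      simp only [Finset.sum_sub_distrib]
      rw [Finset.sum_const, Finset.card_univ, nsmul_eq_mul, hcard, mul_sub]
      congr 1
      rw [Finset.sum_comm]
      have h2 : ∀ i : Fin n, ∑ a' : Fin n → Ω, h j (a' i) = N ^ n * ((∑ w, h j w) / N) := by
        intro i
        have := card_mul_sum_apply (h j) i
        rw [hcard, ← hN] at this
        field_simp
        linarith
      simp only [h2, Finset.sum_const, Finset.card_univ, Fintype.card_fin, nsmul_eq_mul]
      ring
    have h3 : N ^ n * |∑ i, h j (a i) - n * ((∑ w, h j w) / N)|
        = |∑ a' : Fin n → Ω, ∑ i, (h j (a i) - h j (a' i))| := by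
      rw [← h1, abs_mul, abs_of_pos (by positivity : 0 < N ^ n)]
    rw [h3]
    refine (Finset.abs_sum_le_sum_abs _ _).trans (Finset.sum_le_sum fun a' _ => ?_)
    exact Finset.le_sup' (fun j => |∑ i, (h j (a i) - h j (a' i))|) hj
  -- exchanging the two samples in any set of coordinates does not change the average
  have hswap : ∀ ε : Fin n → Bool, D = ∑ a : Fin n → Ω, ∑ a' : Fin n → Ω,
      𝓗.sup' h𝓗 (fun j => |∑ i, boolSign (ε i) * (h j (a i) - h j (a' i))|) := by
    intro ε
    let e : (Fin n → Ω) × (Fin n → Ω) → (Fin n → Ω) × (Fin n → Ω) := fun p =>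
      (fun i => if ε i then p.1 i else p.2 i, fun i => if ε i then p.2 i else p.1 i)
    have he : Function.Involutive e := by
      intro p
      refine Prod.ext (funext fun i => ?_) (funext fun i => ?_) <;> simp only [e] <;>
        split_ifs <;> rfl
    rw [hD, ← Fintype.sum_prod_type', ← Fintype.sum_prod_type']
    refine Fintype.sum_equiv he.toPerm _ _ fun p => ?_
    refine Finset.sup'_congr h𝓗 rfl fun j _ => ?_
    congr 1
    refine Finset.sum_congr rfl fun i _ => ?_
    simp only [Function.Involutive.coe_toPerm, e, boolSign]
    split_ifs <;> ring
  have hsign : ∀ ε : Fin n → Bool, D ≤ 2 * N ^ n * ∑ a : Fin n → Ω,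
      𝓗.sup' h𝓗 (fun j => |∑ i, boolSign (ε i) * h j (a i)|) := by
    intro ε
    set Φ : (Fin n → Ω) → ℝ :=
      fun a => 𝓗.sup' h𝓗 (fun j => |∑ i, boolSign (ε i) * h j (a i)|) with hΦ
    rw [hswap ε]
    have h1 : ∀ a a' : Fin n → Ω,
        𝓗.sup' h𝓗 (fun j => |∑ i, boolSign (ε i) * (h j (a i) - h j (a' i))|) ≤ Φ a + Φ a' := by
      intro a a'
      refine Finset.sup'_le h𝓗 _ fun j hj => ?_
      have h2 := Finset.le_sup' (fun j => |∑ i, boolSign (ε i) * h j (a i)|) hj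
      have h3 := Finset.le_sup' (fun j => |∑ i, boolSign (ε i) * h j (a' i)|) hj
      simp only [mul_sub, Finset.sum_sub_distrib]
      exact (abs_sub _ _).trans (add_le_add h2 h3)
    refine (Finset.sum_le_sum fun a _ => Finset.sum_le_sum fun a' _ => h1 a a').trans_eq ?_
    simp only [Finset.sum_add_distrib, Finset.sum_const, Finset.card_univ, nsmul_eq_mul, hcard]
    rw [← Finset.mul_sum]
    ring
  clear_value D
  have hfin : 2 ^ n * D ≤ 2 * N ^ n * (N ^ n * (2 ^ n * R)) := by
    have h1 : ∑ ε : Fin n → Bool, D ≤ ∑ ε : Fin n → Bool, 2 * N ^ n * ∑ a : Fin n → Ω,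
      𝓗.sup' h𝓗 (fun j => |∑ i, boolSign (ε i) * h j (a i)|) :=
      Finset.sum_le_sum fun ε _ => hsign ε
    rw [← Finset.mul_sum, Finset.sum_comm] at h1
    simp only [Finset.sum_const, Finset.card_univ, Fintype.card_fun, Fintype.card_bool,
      Fintype.card_fin, nsmul_eq_mul, Nat.cast_pow, Nat.cast_ofNat] at h1
    refine h1.trans ?_
    gcongr
    refine (Finset.sum_le_sum fun a _ => hR a).trans_eq ?_
    rw [Finset.sum_const, Finset.card_univ, nsmul_eq_mul, hcard]
  have h2n : (0 : ℝ) < 2 ^ n := by positivity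
  have hNn : (0 : ℝ) < N ^ n := by positivity
  refine le_of_mul_le_mul_left ?_ (mul_pos h2n hNn)
  calc _ = 2 ^ n * (N ^ n * ∑ a : Fin n → Ω, 𝓗.sup' h𝓗
      (fun j => |∑ i, h j (a i) - n * ((∑ w, h j w) / N)|)) := by ring
    _ ≤ 2 ^ n * D := by gcongr
    _ ≤ _ := hfin
    _ = _ := by ring

open Finset in
theorem sum_sup_vc_deviation_le {α : Type*} [DecidableEq α] (A : Finset α) (hA : A.Nonempty)
    (𝓕 : Finset (Finset α)) (h𝓕 : 𝓕.Nonempty) {d : ℕ} (hd : 1 ≤ d) (hvc : 𝓕.vcDim ≤ d) (n : ℕ) :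
    ∑ a : Fin n → A, 𝓕.sup' h𝓕 (fun F => |((univ.filter fun i => (a i : α) ∈ F).card : ℝ)
      - n * ((A ∩ F).card / A.card)|) ≤ (A.card : ℝ) ^ n * (96 * √(d * n)) := by
  classical
  have : Nonempty A := hA.to_subtype
  have h := sum_sup_deviation_le (Ω := A) 𝓕 h𝓕 (fun F w => if (w : α) ∈ F then 1 else 0) n
    (R := 48 * √(d * n)) (fun a => ?_)
  · rw [Fintype.card_coe] at h
    rw [show 96 * √(d * n : ℝ) = 2 * (48 * √(d * n)) by ring]
    convert h using 4 with a _ F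
    · congr 1
      · simp
      · congr 2
        rw [sum_coe_sort A (fun w => if w ∈ F then (1 : ℝ) else 0), sum_boole,
          filter_mem_eq_inter]
  · have hex : ∀ ε : Fin n → Bool, ∃ F ∈ 𝓕,
        𝓕.sup' h𝓕 (fun F => |∑ i, boolSign (ε i) * if (a i : α) ∈ F then 1 else 0|)
          = |∑ i, boolSign (ε i) * if (a i : α) ∈ F then 1 else 0| := fun ε =>
      exists_mem_eq_sup' h𝓕 _
    choose F hF hFeq using hex
    have h1 := sum_abs_signs_le hd (traceFamily (fun i => (a i : α)) 𝓕)
      ((vcDim_traceFamily_le _ _).trans hvc)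
      (fun ε => univ.filter fun i => (a i : α) ∈ F ε) (fun ε => mem_image_of_mem _ (hF ε))
    refine le_trans (le_of_eq ?_) h1
    refine sum_congr rfl fun ε _ => ?_
    rw [hFeq ε, sum_filter]
    simp

open Finset in
/-- Uniform convergence for families of bounded VC-dimension: at least half of all `n`-tuples from
`A` sample every member of `𝓕` to within `η` once `n` is a large multiple of `d / η²`. -/
theorem card_good_tuples {α : Type*} [DecidableEq α] (A : Finset α) (hA : A.Nonempty)
    (𝓕 : Finset (Finset α)) (h𝓕 : 𝓕.Nonempty) {d : ℕ} (hd : 1 ≤ d) (hvc : 𝓕.vcDim ≤ d)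
    {n : ℕ} {η : ℝ} (hη : 0 < η) (hn : 36864 * d ≤ η ^ 2 * n) :
    (A.card : ℝ) ^ n ≤ 2 * ((Fintype.piFinset fun _ : Fin n => A).filter fun a => ∀ F ∈ 𝓕,
      |((univ.filter fun i => a i ∈ F).card : ℝ) - n * ((A ∩ F).card / A.card)| ≤ η * n).card := by
  classical
  have hd0 : (1 : ℝ) ≤ d := by exact_mod_cast hd
  have hn0 : (0 : ℝ) < n := by
    by_contra h
    have : η ^ 2 * (n : ℝ) ≤ 0 := mul_nonpos_of_nonneg_of_nonpos (by positivity) (not_lt.1 h)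
    linarith
  set P : (Fin n → α) → Prop := fun a => ∀ F ∈ 𝓕,
      |((univ.filter fun i => a i ∈ F).card : ℝ) - n * ((A ∩ F).card / A.card)| ≤ η * n with hP
  have hsqrt : 192 * √(d * n) ≤ η * n := by
    have h1 : 192 * √(d * n) = √(36864 * d * n) := by
      rw [mul_assoc (36864 : ℝ), Real.sqrt_mul (by norm_num : (0 : ℝ) ≤ 36864)]
      congr 1
      rw [show (36864 : ℝ) = 192 ^ 2 by norm_num, Real.sqrt_sq (by norm_num)]
    rw [h1]
    refine Real.sqrt_le_iff.2 ⟨by positivity, ?_⟩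
    nlinarith
  have hsum := sum_sup_vc_deviation_le A hA 𝓕 h𝓕 hd hvc n
  set bad : Finset (Fin n → A) := univ.filter fun a => ¬ P fun i => a i with hbad
  have hbadle : (bad.card : ℝ) * (η * n) ≤ (A.card : ℝ) ^ n * (96 * √(d * n)) := by
    refine le_trans ?_ hsum
    rw [← nsmul_eq_mul, ← sum_const]
    refine (sum_le_sum (g := fun a : Fin n → A => 𝓕.sup' h𝓕 (fun F =>
      |((univ.filter fun i => (a i : α) ∈ F).card : ℝ) - n * ((A ∩ F).card / A.card)|))
      fun a ha => ?_).trans (sum_le_sum_of_subset_of_nonneg (subset_univ _) fun a _ _ => ?_)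
    · have := (mem_filter.1 ha).2
      simp only [hP] at this
      push Not at this
      obtain ⟨F, hF, hlt⟩ := this
      exact hlt.le.trans (le_sup' (fun F => |((univ.filter fun i => (a i : α) ∈ F).card : ℝ)
        - n * ((A ∩ F).card / A.card)|) hF)
    · obtain ⟨F, hF⟩ := h𝓕
      exact (abs_nonneg _).trans (le_sup' (fun F => |((univ.filter fun i => (a i : α) ∈ F).card
        : ℝ) - n * ((A ∩ F).card / A.card)|) hF)
  have hbad2 : 2 * (bad.card : ℝ) ≤ (A.card : ℝ) ^ n := by
    have hηn : 0 < η * n := by positivity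
    have hAn : (0 : ℝ) ≤ (A.card : ℝ) ^ n := by positivity
    refine le_of_mul_le_mul_right ?_ hηn
    nlinarith
  have hsplit : ((univ.filter fun a : Fin n → A => P fun i => a i).card : ℝ) + bad.card
      = (A.card : ℝ) ^ n := by
    have := card_filter_add_card_filter_not (s := (univ : Finset (Fin n → A)))
      (fun a => P fun i => a i)
    rw [card_univ, Fintype.card_fun, Fintype.card_coe, Fintype.card_fin] at this
    exact_mod_cast this
  have hle : ((univ.filter fun a : Fin n → A => P fun i => a i).card : ℝ)
      ≤ ((Fintype.piFinset fun _ : Fin n => A).filter P).card := by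
    have : (univ.filter fun a : Fin n → A => P fun i => a i).card
        ≤ ((Fintype.piFinset fun _ : Fin n => A).filter P).card := by
      refine card_le_card_of_injOn (fun a i => (a i : α)) (fun a ha => ?_) ?_
      · refine mem_coe.2 (mem_filter.2 ⟨Fintype.mem_piFinset.2 ?_, ?_⟩)
        exacts [fun i => (a i).2, (mem_filter.1 ha).2]
      · intro a _ a' _ h
        funext i
        exact Subtype.ext (congrFun h i)
    exact_mod_cast this
  linarith

/-! ### Almost periods from sampling -/

/-- The proportion of `A` that lies in the translate `x + A`. -/
noncomputable def selfOverlap {G : Type*} [AddCommGroup G] [DecidableEq G] (A : Finset G)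
    (x : G) : ℝ :=
  ((A ∩ (x +ᵥ A)).card : ℝ) / A.card

open Finset in
/-- Croot–Sisask sampling. Every `s ∈ S` and every good tuple `a` give a tuple `a + s` with entries
in `A + S`; some tuple `b` arises from many `s`, and all these `s` approximate the same function
`x ↦ #{i | b i ∈ x + A}`. -/
theorem exists_almost_periods {G : Type*} [AddCommGroup G] [Fintype G] [DecidableEq G]
    {A S : Finset G} (hA : A.Nonempty) {d : ℕ} (hd : 1 ≤ d)
    (hvc : translateVCDim A ≤ d) {C : ℝ} (hC : ((A + S).card : ℝ) ≤ C * A.card)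
    {η : ℝ} (hη : 0 < η) {n : ℕ} (hn : 36864 * d ≤ η ^ 2 * n) :
    ∃ T ⊆ S, (S.card : ℝ) ≤ 2 * C ^ n * T.card ∧
      ∀ s ∈ T, ∀ s' ∈ T, ∀ x, |selfOverlap A (x + (s - s')) - selfOverlap A x| ≤ 2 * η := by
  classical
  have hd0 : (1 : ℝ) ≤ d := by exact_mod_cast hd
  have hn0 : (0 : ℝ) < n := by
    by_contra h
    have : η ^ 2 * (n : ℝ) ≤ 0 := mul_nonpos_of_nonneg_of_nonpos (by positivity) (not_lt.1 h)
    linarith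
  rcases S.eq_empty_or_nonempty with rfl | hS
  · exact ⟨∅, subset_rfl, by simp, by simp⟩
  have hA0 : (0 : ℝ) < A.card := by exact_mod_cast hA.card_pos
  have hAS : (A + S).Nonempty := hA.add hS
  have hC0 : 0 < C := by
    have : (0 : ℝ) < (A + S).card := by exact_mod_cast hAS.card_pos
    by_contra h
    have : C * A.card ≤ 0 := mul_nonpos_of_nonpos_of_nonneg (not_lt.1 h) hA0.le
    linarith
  set Good : (Fin n → G) → Prop := fun a => ∀ F ∈ univ.image fun g : G => g +ᵥ A,
    |((univ.filter fun i => a i ∈ F).card : ℝ) - n * ((A ∩ F).card / A.card)| ≤ η * n with hGood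
  have hgood : (A.card : ℝ) ^ n
      ≤ 2 * ((Fintype.piFinset fun _ : Fin n => A).filter Good).card := by
    convert card_good_tuples A hA (univ.image fun g : G => g +ᵥ A)
      (univ_nonempty.image _) hd hvc hη hn
  set T : (Fin n → G) → Finset G := fun b =>
    S.filter fun s => (fun i => b i - s) ∈ (Fintype.piFinset fun _ : Fin n => A).filter Good
    with hT
  have hcount : (S.card : ℝ) * ((Fintype.piFinset fun _ : Fin n => A).filter Good).card
      ≤ ∑ b ∈ Fintype.piFinset fun _ : Fin n => A + S, ((T b).card : ℝ) := by
    have h1 : ∑ b ∈ Fintype.piFinset fun _ : Fin n => A + S, (T b).card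
        = ∑ s ∈ S, ((Fintype.piFinset fun _ : Fin n => A + S).filter fun b =>
          (fun i => b i - s) ∈ (Fintype.piFinset fun _ : Fin n => A).filter Good).card := by
      simp only [hT, card_filter]
      exact sum_comm
    have h2 : ∀ s ∈ S, ((Fintype.piFinset fun _ : Fin n => A).filter Good).card
        ≤ ((Fintype.piFinset fun _ : Fin n => A + S).filter fun b =>
          (fun i => b i - s) ∈ (Fintype.piFinset fun _ : Fin n => A).filter Good).card := by
      intro s hs
      refine card_le_card_of_injOn (fun a i => a i + s) (fun a ha => ?_) ?_
      · have ha' := mem_coe.1 ha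
        refine mem_coe.2 (mem_filter.2 ⟨Fintype.mem_piFinset.2 fun i => ?_, ?_⟩)
        · exact add_mem_add (Fintype.mem_piFinset.1 (mem_filter.1 ha').1 i) hs
        · simpa only [add_sub_cancel_right] using ha'
      · intro a _ a' _ h
        funext i
        exact add_right_cancel (congrFun h i)
    have h3 : S.card * ((Fintype.piFinset fun _ : Fin n => A).filter Good).card
        ≤ ∑ b ∈ Fintype.piFinset fun _ : Fin n => A + S, (T b).card := by
      rw [h1, ← smul_eq_mul, ← sum_const]
      exact sum_le_sum h2
    exact_mod_cast h3
  have havg : ∑ b ∈ Fintype.piFinset fun _ : Fin n => A + S, (S.card : ℝ) / (2 * C ^ n)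
      ≤ ∑ b ∈ Fintype.piFinset fun _ : Fin n => A + S, ((T b).card : ℝ) := by
    refine le_trans ?_ hcount
    rw [sum_const, Fintype.card_piFinset_const, nsmul_eq_mul, Nat.cast_pow, mul_div_assoc',
      div_le_iff₀ (by positivity)]
    have h1 : ((A + S).card : ℝ) ^ n ≤ C ^ n * (A.card : ℝ) ^ n := by
      rw [← mul_pow]; gcongr
    calc ((A + S).card : ℝ) ^ n * S.card ≤ (C ^ n * (A.card : ℝ) ^ n) * S.card := by gcongr
      _ ≤ (C ^ n * (2 * ((Fintype.piFinset fun _ : Fin n => A).filter Good).card)) * S.card := by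
          gcongr
      _ = _ := by ring
  obtain ⟨b, -, hb⟩ := exists_le_of_sum_le
    (Fintype.piFinset_nonempty.2 fun _ => hAS) havg
  refine ⟨T b, filter_subset _ _, ?_, ?_⟩
  · rw [div_le_iff₀ (by positivity)] at hb
    linarith
  · intro s hs s' hs' x
    have hmem : ∀ u ∈ T b, ∀ y : G, |((univ.filter fun i => b i ∈ y +ᵥ A).card : ℝ)
        - n * selfOverlap A (y - u)| ≤ η * n := by
      intro u hu y
      have h1 := (mem_filter.1 (mem_filter.1 hu).2).2 ((y - u) +ᵥ A)
        (mem_image_of_mem _ (mem_univ _))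
      have h2 : (univ.filter fun i => b i ∈ y +ᵥ A)
          = univ.filter fun i => b i - u ∈ (y - u) +ᵥ A := by
        refine filter_congr fun i _ => ?_
        rw [← neg_vadd_mem_iff, ← neg_vadd_mem_iff, vadd_eq_add, vadd_eq_add]
        rw [show -(y - u) + (b i - u) = -y + b i by abel]
      rw [h2]
      exact h1
    have h1 := hmem s hs (x + s)
    have h2 := hmem s' hs' (x + s)
    rw [add_sub_cancel_right] at h1
    rw [add_sub_assoc] at h2
    rw [abs_le] at h1 h2 ⊢
    constructor <;> nlinarith

/-! ### Bohr sets -/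

section Bohr

variable {G : Type*} [AddCommGroup G] [Fintype G]

theorem mem_bohrSet {K : Finset (AddChar G ℂ)} {ρ : ℝ} {x : G} :
    x ∈ bohrSet K ρ ↔ ∀ γ ∈ K, ‖γ x - 1‖ ≤ ρ := by
  simp [bohrSet]

theorem bohrSet_mono {K K' : Finset (AddChar G ℂ)} {ρ ρ' : ℝ} (hK : K ⊆ K') (hρ : ρ' ≤ ρ) :
    bohrSet K' ρ' ⊆ bohrSet K ρ := fun _ hx =>
  mem_bohrSet.2 fun γ hγ => (mem_bohrSet.1 hx γ (hK hγ)).trans hρ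

theorem zero_mem_bohrSet (K : Finset (AddChar G ℂ)) {ρ : ℝ} (hρ : 0 ≤ ρ) : 0 ∈ bohrSet K ρ :=
  mem_bohrSet.2 fun γ _ => by simpa using hρ

theorem card_bohrSet_pos (K : Finset (AddChar G ℂ)) {ρ : ℝ} (hρ : 0 ≤ ρ) :
    (0 : ℝ) < (bohrSet K ρ).card := by
  exact_mod_cast Finset.card_pos.2 ⟨0, zero_mem_bohrSet K hρ⟩

theorem norm_addChar_add_sub_one_le (γ : AddChar G ℂ) (x y : G) :
    ‖γ (x + y) - 1‖ ≤ ‖γ x - 1‖ + ‖γ y - 1‖ := by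
  have : γ (x + y) - 1 = (γ x - 1) + γ x * (γ y - 1) := by rw [γ.map_add_eq_mul]; ring
  rw [this]
  refine (norm_add_le _ _).trans ?_
  rw [norm_mul, γ.norm_apply, one_mul]

theorem norm_addChar_sub_sub_one (γ : AddChar G ℂ) (x y : G) :
    ‖γ (x - y) - 1‖ = ‖γ x - γ y‖ := by
  have : γ x - γ y = γ y * (γ (x - y) - 1) := by
    rw [mul_sub, ← γ.map_add_eq_mul, add_sub_cancel, mul_one]
  rw [this, norm_mul, γ.norm_apply, one_mul]

theorem add_mem_bohrSet {K : Finset (AddChar G ℂ)} {ρ₁ ρ₂ : ℝ} {x y : G}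
    (hx : x ∈ bohrSet K ρ₁) (hy : y ∈ bohrSet K ρ₂) : x + y ∈ bohrSet K (ρ₁ + ρ₂) :=
  mem_bohrSet.2 fun γ hγ => (norm_addChar_add_sub_one_le γ x y).trans
    (add_le_add (mem_bohrSet.1 hx γ hγ) (mem_bohrSet.1 hy γ hγ))

theorem neg_mem_bohrSet {K : Finset (AddChar G ℂ)} {ρ : ℝ} {x : G}
    (hx : x ∈ bohrSet K ρ) : -x ∈ bohrSet K ρ :=
  mem_bohrSet.2 fun γ hγ => by
    rw [← zero_sub, norm_addChar_sub_sub_one, γ.map_zero_eq_one, norm_sub_rev]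
    exact mem_bohrSet.1 hx γ hγ

/-- Chords of the unit circle are at most as long as differences of arguments. -/
theorem norm_sub_le_abs_arg_sub {z w : ℂ} (hz : ‖z‖ = 1) (hw : ‖w‖ = 1) :
    ‖z - w‖ ≤ |z.arg - w.arg| := by
  have hz' : z = Complex.exp (z.arg * Complex.I) := by
    have := Complex.norm_mul_exp_arg_mul_I z
    rw [hz] at this; simpa using this.symm
  have hw' : w = Complex.exp (w.arg * Complex.I) := by
    have := Complex.norm_mul_exp_arg_mul_I w
    rw [hw] at this; simpa using this.symm
  have h : z - w = w * (Complex.exp (Complex.I * ((z.arg - w.arg : ℝ) : ℂ)) - 1) := by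
    rw [mul_sub, mul_one]
    congr 1
    conv_lhs => rw [hz']
    conv_rhs => rw [hw']
    rw [← Complex.exp_add]
    congr 1
    push_cast
    rw [← hw']
    ring
  rw [h, norm_mul, hw, one_mul]
  exact Real.norm_exp_I_mul_ofReal_sub_one_le

open Finset in
/-- Cutting the arc of each frequency into eight cells of length `ρ` splits any subset of
`B(K, 2ρ)` into at most `8 ^ |K|` pieces, each with differences in `B(K, ρ)`. -/
theorem exists_subset_sub_mem_bohrSet (K : Finset (AddChar G ℂ)) {ρ : ℝ} (hρ : 0 < ρ)
    {S : Finset G} (hS : S ⊆ bohrSet K (2 * ρ)) :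
    ∃ S' ⊆ S, (S.card : ℝ) ≤ 8 ^ K.card * S'.card ∧
      ∀ x ∈ S', ∀ y ∈ S', x - y ∈ bohrSet K ρ := by
  classical
  set φ : G → K → ℤ := fun x γ => ⌊(γ.1 x).arg / ρ⌋ with hφ
  set t : Finset (K → ℤ) := Fintype.piFinset fun _ => Icc (-4) 3 with ht
  have htcard : t.card = 8 ^ K.card := by
    rw [ht, Fintype.card_piFinset]
    simp
  have hmaps : ∀ x ∈ S, φ x ∈ t := by
    intro x hx
    refine Fintype.mem_piFinset.2 fun γ => mem_Icc.2 ?_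
    have h1 := mem_bohrSet.1 (hS hx) γ.1 γ.2
    have hz : ‖γ.1 x‖ = 1 := γ.1.norm_apply x
    have hz0 : γ.1 x ≠ 0 := fun h => by rw [h] at hz; simp at hz
    have h2 := Complex.angle_le_mul_norm_sub (x := 1) (y := γ.1 x) (by simp) hz
    rw [Complex.angle_one_left hz0, norm_sub_rev] at h2
    have h3 : |(γ.1 x).arg| < 4 * ρ := by
      have := Real.pi_lt_four
      have := Real.pi_pos
      calc _ ≤ Real.pi / 2 * (2 * ρ) := h2.trans (by gcongr)
        _ = Real.pi * ρ := by ring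
        _ < _ := by gcongr
    rw [abs_lt] at h3
    constructor
    · rw [Int.le_floor, le_div_iff₀ hρ]; push_cast; linarith
    · rw [← Int.lt_add_one_iff, Int.floor_lt, div_lt_iff₀ hρ]; push_cast; linarith
  have htne : t.Nonempty := by rw [← card_pos, htcard]; positivity
  obtain ⟨c, -, hcmax⟩ := exists_max_image t (fun c => (S.filter fun x => φ x = c).card) htne
  refine ⟨S.filter fun x => φ x = c, filter_subset _ _, ?_, ?_⟩
  · have := card_le_mul_card_image_of_maps_to hmaps _ hcmax
    rw [htcard, mul_comm] at this
    exact_mod_cast this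
  · intro x hx y hy
    refine mem_bohrSet.2 fun γ hγ => ?_
    rw [norm_addChar_sub_sub_one]
    refine (norm_sub_le_abs_arg_sub (γ.norm_apply x) (γ.norm_apply y)).trans ?_
    have h : φ x ⟨γ, hγ⟩ = φ y ⟨γ, hγ⟩ := by rw [(mem_filter.1 hx).2, (mem_filter.1 hy).2]
    have h2 := Int.abs_sub_lt_one_of_floor_eq_floor h
    simp only at h2
    rw [← sub_div, abs_div, abs_of_pos hρ, div_lt_one hρ] at h2
    exact h2.le

theorem card_bohrSet_two_mul_le (K : Finset (AddChar G ℂ)) {ρ : ℝ} (hρ : 0 < ρ) :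
    ((bohrSet K (2 * ρ)).card : ℝ) ≤ 8 ^ K.card * (bohrSet K ρ).card := by
  classical
  obtain ⟨S, -, hcard, hS⟩ := exists_subset_sub_mem_bohrSet K hρ (subset_refl _)
  refine hcard.trans (mul_le_mul_of_nonneg_left (Nat.cast_le.2 ?_) (by positivity))
  rcases S.eq_empty_or_nonempty with rfl | ⟨y, hy⟩
  · simp
  · exact Finset.card_le_card_of_injOn (fun x => x - y) (fun x hx => hS x hx y hy)
      fun a _ b _ h => sub_left_injective h

/-! ### Regular widths -/

theorem sum_sub_le_of_disjoint {ι : Type*} {f : ℝ → ℝ} (hf : Monotone f) (p q : ι → ℝ)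
    (hpq : ∀ i, p i ≤ q i) {a : ℝ} (s : Finset ι)
    (hdis : (s : Set ι).PairwiseDisjoint fun i => Set.Icc (p i) (q i)) (ha : ∀ i ∈ s, a ≤ p i)
    {b : ℝ} (hab : a ≤ b) (hb : ∀ i ∈ s, q i ≤ b) :
    ∑ i ∈ s, (f (q i) - f (p i)) ≤ f b - f a := by
  classical
  induction s using Finset.induction_on_max_value p generalizing b with
  | empty => simpa using hf hab
  | insert i s hi hmax ih =>
    rw [Finset.sum_insert hi]
    have h1 : ∑ j ∈ s, (f (q j) - f (p j)) ≤ f (p i) - f a :=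
      ih (hdis.subset (by simp)) (fun j hj => ha j (Finset.mem_insert_of_mem hj))
      (ha i (Finset.mem_insert_self _ _)) (fun j hj => by
        by_contra! hlt
        have hne : j ≠ i := fun h => hi (h ▸ hj)
        have := hdis (by simp [hj]) (by simp) hne
        exact Set.disjoint_left.1 this (show p i ∈ Set.Icc _ _ from ⟨hmax j hj, hlt.le⟩)
          ⟨le_rfl, hpq i⟩)
    have h2 := hf (hb i (Finset.mem_insert_self _ _))
    linarith

/-- A covering lemma: if every point of `[a, b]` lies in a short interval on which the monotone
function `f` grows with slope at least `L`, then `f` grows by at least `L (b - a) / 5`. -/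
theorem mul_le_growth_of_steep_cover {f : ℝ → ℝ} (hf : Monotone f) {a b L κ : ℝ} (hab : a ≤ b)
    (hL : 0 < L) (p q : ℝ → ℝ)
    (hpq : ∀ u ∈ Set.Icc a b, p u < q u ∧ p u ≤ u ∧ u ≤ q u ∧ q u - p u ≤ κ ∧
      L * (q u - p u) ≤ f (q u) - f (p u)) :
    L * (b - a) ≤ 5 * (f (b + κ) - f (a - κ)) := by
  have hball : ∀ u c, Metric.closedBall ((p u + q u) / 2) (c * ((q u - p u) / 2))
      = Set.Icc ((p u + q u) / 2 - c * ((q u - p u) / 2))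
        ((p u + q u) / 2 + c * ((q u - p u) / 2)) := fun u c => Real.closedBall_eq_Icc
  have hball1 : ∀ u, Metric.closedBall ((p u + q u) / 2) ((q u - p u) / 2)
      = Set.Icc (p u) (q u) := fun u => by
    rw [Real.closedBall_eq_Icc]; congr 1 <;> ring
  obtain ⟨U, hUt, hUdis, hUcov⟩ := Vitali.exists_disjoint_subfamily_covering_enlargement_closedBall
    (Set.Icc a b) (fun u => (p u + q u) / 2) (fun u => (q u - p u) / 2) (κ / 2)
    (fun u hu => by have := (hpq u hu).2.2.2.1; linarith) 5 (by norm_num)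
  simp only [hball1] at hUdis hUcov
  have hUcount : U.Countable := by
    refine hUdis.countable_of_nonempty_interior fun u hu => ?_
    rw [interior_Icc]
    exact Set.nonempty_Ioo.2 (hpq u (hUt hu)).1
  have hcover : Set.Icc a b ⊆ ⋃ u ∈ U,
      Metric.closedBall ((p u + q u) / 2) (5 * ((q u - p u) / 2)) := by
    intro u hu
    obtain ⟨v, hv, hsub⟩ := hUcov u hu
    have := hpq u hu
    exact Set.mem_biUnion hv (hsub ⟨this.2.1, this.2.2.1⟩)
  have hκ : 0 ≤ κ := by
    have := hpq a ⟨le_rfl, hab⟩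
    linarith [this.1, this.2.2.2.1]
  have hgrow : 0 ≤ f (b + κ) - f (a - κ) := sub_nonneg.2 (hf (by linarith))
  have hmeas : MeasureTheory.volume (Set.Icc a b)
      ≤ ENNReal.ofReal (5 / L * (f (b + κ) - f (a - κ))) := by
    refine (MeasureTheory.measure_mono hcover).trans ?_
    refine (MeasureTheory.measure_biUnion_le _ hUcount _).trans ?_
    rw [ENNReal.tsum_eq_iSup_sum]
    refine iSup_le fun s => ?_
    have hterm : ∀ u : U, MeasureTheory.volume
        (Metric.closedBall ((p u + q u) / 2) (5 * ((q u - p u) / 2)))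
        ≤ ENNReal.ofReal (5 / L * (f (q u) - f (p u))) := by
      intro u
      rw [Real.volume_closedBall]
      refine ENNReal.ofReal_le_ofReal ?_
      have := (hpq u (hUt u.2)).2.2.2.2
      rw [div_mul_eq_mul_div, le_div_iff₀ hL]
      linarith
    refine (Finset.sum_le_sum fun u _ => hterm u).trans ?_
    rw [← ENNReal.ofReal_sum_of_nonneg (fun u _ => ?_)]
    · refine ENNReal.ofReal_le_ofReal ?_
      rw [← Finset.mul_sum]
      gcongr
      refine sum_sub_le_of_disjoint hf (fun u : U => p u) (fun u : U => q u)
        (fun u => (hpq u (hUt u.2)).1.le) s ?_ (fun u _ => ?_) (by linarith) (fun u _ => ?_)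
      · intro u _ v _ huv
        exact hUdis u.2 v.2 fun h => huv (Subtype.ext h)
      · have h1 := hpq u (hUt u.2)
        have h2 := (hUt u.2).1
        linarith [h1.2.2.1, h1.2.2.2.1]
      · have h1 := hpq u (hUt u.2)
        have h2 := (hUt u.2).2
        linarith [h1.2.1, h1.2.2.2.1]
    · have := hpq u (hUt u.2)
      have : 0 ≤ f (q u) - f (p u) := sub_nonneg.2 (hf this.1.le)
      positivity
  rw [Real.volume_Icc, ENNReal.ofReal_le_ofReal_iff (by positivity), div_mul_eq_mul_div,
    le_div_iff₀ hL] at hmeas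
  linarith

/-- Bourgain's lemma: regular widths exist at every scale. In the variable `u = log ρ`, a width
that is not regular lies in an interval on which `log |B(K, exp u)|` has slope at least `50 |K|`;
by the covering lemma such intervals cannot fill an interval of length `log 2`. -/
theorem exists_isRegularBohr (K : Finset (AddChar G ℂ)) {ρ : ℝ} (hρ : 0 < ρ) :
    ∃ ρ', ρ / 2 ≤ ρ' ∧ ρ' ≤ ρ ∧ IsRegularBohr K ρ' := by
  rcases Nat.eq_zero_or_pos K.card with hK | hK
  · refine ⟨ρ, by linarith, le_rfl, fun ε h1 h2 => ?_⟩
    rw [hK] at h2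
    norm_num at h2
    linarith
  by_contra! hcon
  set r : ℝ := (K.card : ℝ) with hr
  have hr1 : 1 ≤ r := by rw [hr]; exact_mod_cast hK
  set f : ℝ → ℝ := fun u => Real.log (bohrSet K (Real.exp u)).card with hf
  have hcardpos : ∀ u : ℝ, (0 : ℝ) < (bohrSet K (Real.exp u)).card := fun u =>
    card_bohrSet_pos K (Real.exp_pos u).le
  have hmono : Monotone f := by
    intro u v huv
    refine Real.log_le_log (hcardpos u) ?_
    exact_mod_cast Finset.card_le_card (bohrSet_mono subset_rfl (Real.exp_le_exp.2 huv))
  have hsteep : ∀ u ∈ Set.Icc (Real.log (ρ / 2)) (Real.log ρ), ∃ p q : ℝ, p < q ∧ p ≤ u ∧ u ≤ q ∧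
      q - p ≤ 1 / 50 ∧ 50 * r * (q - p) ≤ f q - f p := by
    intro u hu
    have h1 : ρ / 2 ≤ Real.exp u := by
      rw [← Real.log_le_iff_le_exp (by positivity)]; exact hu.1
    have h2 : Real.exp u ≤ ρ := by
      rw [← Real.le_log_iff_exp_le hρ]; exact hu.2
    have h3 := hcon _ h1 h2
    rw [IsRegularBohr] at h3
    push Not at h3
    obtain ⟨ε, hε, hε1, h3⟩ := h3
    have hy : 100 * r * ε < 1 := by
      rw [lt_div_iff₀ (by positivity)] at hε1; linarith
    have hy0 : 0 < 100 * r * ε := by positivity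
    have hε2 : ε < 1 / 100 := by nlinarith
    rcases lt_or_ge (((bohrSet K (Real.exp u)).card : ℝ) * (1 + 100 * r * ε))
      ((bohrSet K (Real.exp u * (1 + ε))).card : ℝ) with h4 | h4
    · refine ⟨u, u + Real.log (1 + ε), ?_, le_rfl, ?_, ?_, ?_⟩
      · have := Real.log_pos (by linarith : 1 < 1 + ε); linarith
      · have := Real.log_pos (by linarith : 1 < 1 + ε); linarith
      · have := Real.log_le_sub_one_of_pos (by linarith : 0 < 1 + ε); linarith
      · have h5 : Real.log (1 + 100 * r * ε) ≤ f (u + Real.log (1 + ε)) - f u := by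
          rw [le_sub_iff_add_le, add_comm]
          simp only [hf]
          rw [← Real.log_mul (hcardpos u).ne' (by positivity), Real.exp_add,
            Real.exp_log (by linarith)]
          exact Real.log_le_log (by have := hcardpos u; positivity) h4.le
        have h6 : 50 * r * ε ≤ Real.log (1 + 100 * r * ε) := by
          refine le_trans ?_ (Real.one_sub_inv_le_log_of_pos (by linarith))
          have : (1 + 100 * r * ε)⁻¹ ≤ 1 - 50 * r * ε := by
            rw [inv_le_iff_one_le_mul₀ (by linarith)]
            nlinarith
          linarith
        have h7 := Real.log_le_sub_one_of_pos (by linarith : 0 < 1 + ε)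
        have h8 : 50 * r * (u + Real.log (1 + ε) - u) ≤ 50 * r * ε := by
          gcongr; linarith
        linarith
    · have h3 := h3 h4
      have hl : Real.log (1 - ε) < 0 := Real.log_neg (by linarith) (by linarith)
      have hl2 : -(2 * ε) ≤ Real.log (1 - ε) := by
        refine le_trans ?_ (Real.one_sub_inv_le_log_of_pos (by linarith))
        have : (1 - ε)⁻¹ ≤ 1 + 2 * ε := by
          rw [inv_le_iff_one_le_mul₀ (by linarith)]
          nlinarith
        linarith
      refine ⟨u + Real.log (1 - ε), u, by linarith, by linarith, le_rfl, by linarith, ?_⟩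
      have h5 : f (u + Real.log (1 - ε)) ≤ f u + Real.log (1 - 100 * r * ε) := by
        simp only [hf]
        rw [← Real.log_mul (hcardpos u).ne' (by linarith), Real.exp_add,
          Real.exp_log (by linarith)]
        have h6 := hcardpos (u + Real.log (1 - ε))
        rw [Real.exp_add, Real.exp_log (by linarith)] at h6
        exact Real.log_le_log h6 h3.le
      have h6 := Real.log_le_sub_one_of_pos (by linarith : 0 < 1 - 100 * r * ε)
      have h7 : 50 * r * (u - (u + Real.log (1 - ε))) ≤ 50 * r * (2 * ε) := by
        gcongr; linarith
      linarith
  choose! p q hpq using hsteep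
  have hlog : Real.log ρ - Real.log (ρ / 2) = Real.log 2 := by
    rw [Real.log_div hρ.ne' (by norm_num)]; ring
  have hl2 : 0 < Real.log 2 := Real.log_pos (by norm_num)
  have hmain := mul_le_growth_of_steep_cover hmono (by linarith) (by positivity) p q hpq
  -- the total growth is at most that from `ρ / 4` to `2 ρ`, three doublings
  have hup : f (Real.log ρ + 1 / 50) ≤ f (Real.log (2 * ρ)) := by
    refine hmono ?_
    rw [Real.log_mul (by norm_num) hρ.ne']
    linarith [Real.log_two_gt_d9]
  have hlow : f (Real.log (ρ / 4)) ≤ f (Real.log (ρ / 2) - 1 / 50) := by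
    refine hmono ?_
    rw [show ρ / 4 = ρ / 2 / 2 by ring, Real.log_div (x := ρ / 2) (by positivity) (by norm_num)]
    linarith [Real.log_two_gt_d9]
  have hdouble : f (Real.log (2 * ρ)) ≤ 9 * r * Real.log 2 + f (Real.log (ρ / 4)) := by
    simp only [hf]
    rw [Real.exp_log (by positivity), Real.exp_log (by positivity)]
    have h1 := card_bohrSet_two_mul_le K hρ
    have h2 := card_bohrSet_two_mul_le K (half_pos hρ)
    have h3 := card_bohrSet_two_mul_le K (half_pos (half_pos hρ))
    rw [mul_div_cancel₀ ρ two_ne_zero] at h2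
    rw [mul_div_cancel₀ (ρ / 2) two_ne_zero, show ρ / 2 / 2 = ρ / 4 by ring] at h3
    have h4 : ((bohrSet K (2 * ρ)).card : ℝ) ≤ 2 ^ (9 * K.card) * (bohrSet K (ρ / 4)).card := by
      have h8 : (8 : ℝ) ^ K.card * (8 ^ K.card * 8 ^ K.card) = 2 ^ (9 * K.card) := by
        rw [show (8 : ℝ) = 2 ^ 3 by norm_num]
        simp only [← pow_mul, ← pow_add]
        congr 1; ring
      calc _ ≤ (8 : ℝ) ^ K.card * (8 ^ K.card * (8 ^ K.card * (bohrSet K (ρ / 4)).card)) := by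
            refine h1.trans ?_; gcongr; refine h2.trans ?_; gcongr
        _ = _ := by rw [← h8]; ring
    have h5 := card_bohrSet_pos K (by positivity : 0 ≤ ρ / 4)
    have h6 := card_bohrSet_pos K (by positivity : 0 ≤ 2 * ρ)
    refine (Real.log_le_log h6 h4).trans_eq ?_
    rw [Real.log_mul (by positivity) h5.ne', Real.log_pow]
    push_cast
    ring
  rw [hlog] at hmain
  nlinarith [mul_pos (by linarith : 0 < r) hl2]

/-- The upper half of regularity, with the constant stated for rank `max 1 |K|` so that it also
covers the empty set of frequencies. -/
theorem IsRegularBohr.card_le {K : Finset (AddChar G ℂ)} {ρ : ℝ} (h : IsRegularBohr K ρ) {ε : ℝ}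
    (hε : 0 < ε) (hε1 : 100 * max 1 (K.card : ℝ) * ε < 1) :
    ((bohrSet K (ρ * (1 + ε))).card : ℝ)
      ≤ (bohrSet K ρ).card * (1 + 100 * max 1 (K.card : ℝ) * ε) := by
  rcases K.eq_empty_or_nonempty with rfl | hK
  · have : bohrSet (∅ : Finset (AddChar G ℂ)) (ρ * (1 + ε)) = bohrSet ∅ ρ := by
      ext; simp [mem_bohrSet]
    rw [this]
    refine le_mul_of_one_le_right (by positivity) ?_
    have : (0 : ℝ) ≤ 100 * max 1 ((∅ : Finset (AddChar G ℂ)).card : ℝ) * ε := by positivity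
    linarith
  · have hc : (1 : ℝ) ≤ K.card := by exact_mod_cast hK.card_pos
    rw [max_eq_right hc] at hε1 ⊢
    refine (h ε hε ?_).1
    rw [lt_div_iff₀ (by positivity)]
    linarith

open Finset in
/-- A character that correlates with a regular Bohr set is nearly constant on a smaller dilate. -/
theorem IsRegularBohr.norm_sub_one_mul_le {K : Finset (AddChar G ℂ)} {ρ : ℝ}
    (h : IsRegularBohr K ρ) {ε : ℝ} (hε : 0 < ε)
    (hε1 : 100 * max 1 (K.card : ℝ) * ε < 1) (γ : AddChar G ℂ) {t : G}
    (ht : t ∈ bohrSet K (ρ * ε)) :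
    ‖γ t - 1‖ * ‖∑ x ∈ bohrSet K ρ, γ x‖
      ≤ 200 * max 1 (K.card : ℝ) * ε * (bohrSet K ρ).card := by
  classical
  set B := bohrSet K ρ with hB
  have hsub : t +ᵥ B ⊆ bohrSet K (ρ * (1 + ε)) := by
    intro y hy
    obtain ⟨x, hx, rfl⟩ := mem_vadd_finset.1 hy
    rw [vadd_eq_add, show ρ * (1 + ε) = ρ * ε + ρ by ring]
    exact add_mem_bohrSet ht hx
  have hρε : 0 ≤ ρ * ε ∨ K = ∅ := by
    rcases K.eq_empty_or_nonempty with h | ⟨γ, hγ⟩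
    · exact Or.inr h
    · exact Or.inl ((norm_nonneg _).trans (mem_bohrSet.1 ht γ hγ))
  have hsub2 : B ⊆ bohrSet K (ρ * (1 + ε)) := by
    rcases hρε with h | rfl
    · exact bohrSet_mono subset_rfl (by linarith)
    · intro x _; simp [mem_bohrSet]
  have hcard : ((t +ᵥ B) \ B).card = (B \ (t +ᵥ B)).card :=
    card_sdiff_comm (card_vadd_finset t B)
  have hcard2 : (((t +ᵥ B) \ B).card : ℝ) ≤ 100 * max 1 (K.card : ℝ) * ε * B.card := by
    have h1 : ((t +ᵥ B) \ B).card + B.card ≤ (bohrSet K (ρ * (1 + ε))).card := by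
      rw [card_sdiff_add_card]
      exact card_le_card (union_subset hsub hsub2)
    have h2 : (((t +ᵥ B) \ B).card : ℝ) + B.card ≤ (bohrSet K (ρ * (1 + ε))).card := by
      exact_mod_cast h1
    have h3 := h.card_le hε hε1
    linarith
  have hsum : (γ t - 1) * ∑ x ∈ B, γ x = ∑ x ∈ (t +ᵥ B) \ B, γ x - ∑ x ∈ B \ (t +ᵥ B), γ x := by
    rw [sum_sdiff_sub_sum_sdiff, sub_mul, one_mul]
    congr 1
    rw [mul_sum]
    simp only [← γ.map_add_eq_mul]
    exact (sum_image (f := fun x => γ x) (g := fun x => t + x)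
      fun a _ b _ h => add_left_cancel h).symm
  have hbound : ∀ s : Finset G, ‖∑ x ∈ s, γ x‖ ≤ s.card := fun s => by
    refine (norm_sum_le _ _).trans_eq ?_
    simp [γ.norm_apply]
  rw [← norm_mul, hsum]
  refine (norm_sub_le _ _).trans ?_
  have h1 := hbound ((t +ᵥ B) \ B)
  have h2 := hbound (B \ (t +ᵥ B))
  rw [← hcard] at h2
  linarith

end Bohr

/-! ### Dissociation relative to a Bohr set -/

/-- The sums of a character over `Y + l Z`, counted with multiplicity. -/
theorem sum_addChar_add_sum {G : Type*} [AddCommGroup G] (Y Z : Finset G) (l : ℕ)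
    (χ : AddChar G ℂ) :
    ∑ z ∈ Fintype.piFinset fun _ : Fin l => Z, ∑ y ∈ Y, χ (y + ∑ i, z i)
      = (∑ y ∈ Y, χ y) * (∑ x ∈ Z, χ x) ^ l := by
  rw [Finset.sum_pow', Finset.mul_sum]
  refine Finset.sum_congr rfl fun z _ => ?_
  rw [Finset.sum_mul]
  refine Finset.sum_congr rfl fun y _ => ?_
  have : χ (∑ i, z i) = ∏ i, χ (z i) := by
    calc χ (∑ i, z i) = (AddChar.doubleDualEmb (∑ i, z i) : AddChar (AddChar G ℂ) ℂ) χ := rfl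
      _ = _ := by rw [map_sum, AddChar.sum_apply]; rfl
  rw [χ.map_add_eq_mul, this]

section Chang

variable {G : Type*} [AddCommGroup G] [Fintype G]

theorem norm_addChar_sum_sub_one_le {ι : Type*} (γ : AddChar G ℂ) (s : Finset ι) (z : ι → G) :
    ‖γ (∑ i ∈ s, z i) - 1‖ ≤ ∑ i ∈ s, ‖γ (z i) - 1‖ := by
  classical
  induction s using Finset.induction_on with
  | empty => simp
  | insert i s hi ih =>
    rw [Finset.sum_insert hi, Finset.sum_insert hi]
    exact (norm_addChar_add_sub_one_le γ _ _).trans (by gcongr)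

theorem norm_sum_addChar_sub_one_le {ι : Type*} (s : Finset ι) (χ : ι → AddChar G ℂ) (x : G) :
    ‖(∑ i ∈ s, χ i) x - 1‖ ≤ ∑ i ∈ s, ‖χ i x - 1‖ := by
  have h := norm_addChar_sum_sub_one_le (AddChar.doubleDualEmb x : AddChar (AddChar G ℂ) ℂ) s χ
  simpa using h

theorem norm_zsmul_addChar_sub_one_le {j : ℤ} (hj : j ∈ Finset.Icc (-1 : ℤ) 1)
    (χ : AddChar G ℂ) (x : G) : ‖(j • χ) x - 1‖ ≤ ‖χ x - 1‖ := by
  obtain ⟨h1, h2⟩ := Finset.mem_Icc.1 hj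
  interval_cases j
  · rw [neg_one_zsmul, AddChar.neg_apply, ← zero_sub, norm_addChar_sub_sub_one,
      χ.map_zero_eq_one, norm_sub_rev]
  · simp
  · simp

/-- The coefficient vectors on `Λ` with entries in `{-1, 0, 1}`, as functions on the dual group
that vanish off `Λ`. -/
noncomputable def signVectors (Λ : Finset (AddChar G ℂ)) : Finset (AddChar G ℂ → ℤ) :=
  open Classical in Fintype.piFinset fun χ => if χ ∈ Λ then Finset.Icc (-1) 1 else {0}

theorem mem_signVectors {Λ : Finset (AddChar G ℂ)} {m : AddChar G ℂ → ℤ} :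
    m ∈ signVectors Λ ↔ (∀ χ, m χ ∈ Finset.Icc (-1 : ℤ) 1) ∧ ∀ χ ∉ Λ, m χ = 0 := by
  classical
  rw [signVectors, Fintype.mem_piFinset]
  constructor
  · intro h
    refine ⟨fun χ => ?_, fun χ hχ => by simpa [hχ] using h χ⟩
    have := h χ
    split_ifs at this with hχ
    · exact this
    · rw [Finset.mem_singleton.1 this]; simp
  · rintro ⟨h1, h2⟩ χ
    split_ifs with hχ
    · exact h1 χ
    · exact Finset.mem_singleton.2 (h2 χ hχ)

/-- `Λ` is dissociated relative to `Z`: no nontrivial combination of its members with coefficients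
in `{-1, 0, 1}` has a mean of modulus more than `1 / 3` over `Z`. -/
def IsDissociatedOn (Z : Finset G) (Λ : Finset (AddChar G ℂ)) : Prop :=
  ∀ m ∈ signVectors Λ, m ≠ 0 → ‖∑ x ∈ Z, (∑ χ, m χ • χ) x‖ ≤ Z.card / 3

theorem IsDissociatedOn.mono {Z : Finset G} {Λ Λ' : Finset (AddChar G ℂ)}
    (h : IsDissociatedOn Z Λ) (hsub : Λ' ⊆ Λ) : IsDissociatedOn Z Λ' := fun m hm hm0 =>
  h m (mem_signVectors.2 ⟨(mem_signVectors.1 hm).1, fun χ hχ =>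
    (mem_signVectors.1 hm).2 χ fun h => hχ (hsub h)⟩) hm0

/-- The coefficients of the Riesz product attached to `Λ` and the unimodular weights `w`. -/
noncomputable def rieszCoeff (Λ : Finset (AddChar G ℂ)) (w : AddChar G ℂ → ℂ) (s : ℝ)
    (χ : AddChar G ℂ) (j : ℤ) : ℂ :=
  open Classical in
  if χ ∈ Λ then
    if j = 0 then (Real.cosh s : ℂ)
    else if j = 1 then (Real.sinh s : ℂ) / 2 * w χ
    else (Real.sinh s : ℂ) / 2 * (starRingEnd ℂ) (w χ)
  else 1

theorem sum_Icc_neg_one_one {M : Type*} [AddCommMonoid M] (f : ℤ → M) :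
    ∑ j ∈ Finset.Icc (-1 : ℤ) 1, f j = f (-1) + f 0 + f 1 := by
  have : Finset.Icc (-1 : ℤ) 1 = {-1, 0, 1} := by decide
  rw [this, Finset.sum_insert (by decide), Finset.sum_insert (by decide), Finset.sum_singleton,
    add_assoc]

theorem prod_riesz_eq (Λ : Finset (AddChar G ℂ)) (w : AddChar G ℂ → ℂ) (s : ℝ) (x : G) :
    ((∏ χ ∈ Λ, (Real.cosh s + Real.sinh s * (w χ * χ x).re) : ℝ) : ℂ)
      = ∑ m ∈ signVectors Λ, (∏ χ, rieszCoeff Λ w s χ (m χ)) * (∑ χ, m χ • χ) x := by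
  classical
  have h1 : ∀ m : AddChar G ℂ → ℤ, (∏ χ, rieszCoeff Λ w s χ (m χ)) * (∑ χ, m χ • χ) x
      = ∏ χ, (rieszCoeff Λ w s χ (m χ) * (m χ • χ) x) := fun m => by
    rw [AddChar.sum_apply, Finset.prod_mul_distrib]
  simp only [h1]
  rw [signVectors, ← Finset.prod_univ_sum (fun χ => if χ ∈ Λ then Finset.Icc (-1) 1 else {0})
    (fun χ j => rieszCoeff Λ w s χ j * (j • χ) x)]
  have h2 : ∀ χ : AddChar G ℂ, ∑ j ∈ (if χ ∈ Λ then Finset.Icc (-1 : ℤ) 1 else {0}),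
      rieszCoeff Λ w s χ j * (j • χ) x
      = if χ ∈ Λ then ((Real.cosh s + Real.sinh s * (w χ * χ x).re : ℝ) : ℂ) else 1 := by
    intro χ
    by_cases hχ : χ ∈ Λ
    · rw [if_pos hχ, if_pos hχ, sum_Icc_neg_one_one]
      have hre : (((w χ * χ x).re : ℝ) : ℂ)
          = (w χ * χ x + (starRingEnd ℂ) (w χ) * (starRingEnd ℂ) (χ x)) / 2 := by
        rw [← map_mul, Complex.re_eq_add_conj]
      push_cast
      rw [hre]
      simp only [rieszCoeff, hχ, if_true]
      norm_num [AddChar.map_neg_eq_conj]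
      ring
    · simp [hχ, rieszCoeff]
  simp only [h2]
  rw [Finset.prod_ite_mem, Finset.univ_inter]
  push_cast
  rfl

theorem sum_norm_rieszCoeff (Λ : Finset (AddChar G ℂ)) (w : AddChar G ℂ → ℂ)
    (hw : ∀ χ, ‖w χ‖ = 1) {s : ℝ} (hs : 0 ≤ s) :
    ∑ m ∈ signVectors Λ, ‖∏ χ, rieszCoeff Λ w s χ (m χ)‖ = Real.exp s ^ Λ.card := by
  classical
  simp only [norm_prod]
  rw [signVectors, ← Finset.prod_univ_sum (fun χ => if χ ∈ Λ then Finset.Icc (-1) 1 else {0})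
    (fun χ j => ‖rieszCoeff Λ w s χ j‖)]
  have h2 : ∀ χ : AddChar G ℂ, ∑ j ∈ (if χ ∈ Λ then Finset.Icc (-1 : ℤ) 1 else {0}),
      ‖rieszCoeff Λ w s χ j‖ = if χ ∈ Λ then Real.exp s else 1 := by
    intro χ
    by_cases hχ : χ ∈ Λ
    · rw [if_pos hχ, if_pos hχ, sum_Icc_neg_one_one]
      have h3 : 0 ≤ Real.sinh s := Real.sinh_nonneg_iff.2 hs
      have h4 : 0 < Real.cosh s := Real.cosh_pos s
      simp only [rieszCoeff, hχ, if_true]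
      norm_num [abs_of_nonneg h3, abs_of_pos h4, ← Complex.ofReal_cosh, ← Complex.ofReal_sinh,
        Complex.norm_real, hw]
      rw [← Real.cosh_add_sinh]
      ring
    · simp [hχ, rieszCoeff]
  simp only [h2]
  rw [Finset.prod_ite_mem, Finset.univ_inter, Finset.prod_const]

/-- On average over `Y + l Z` the Riesz product of a set dissociated relative to `Z` is close to
its constant coefficient: the other coefficients are damped by the factor `3⁻ˡ`. -/
theorem sum_riesz_le (Y Z : Finset G) (l : ℕ) {Λ : Finset (AddChar G ℂ)}
    (hΛ : IsDissociatedOn Z Λ) (w : AddChar G ℂ → ℂ) (hw : ∀ χ, ‖w χ‖ = 1) {s : ℝ} (hs : 0 ≤ s) :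
    ∑ z ∈ Fintype.piFinset fun _ : Fin l => Z, ∑ y ∈ Y,
        ∏ χ ∈ Λ, (Real.cosh s + Real.sinh s * (w χ * χ (y + ∑ i, z i)).re)
      ≤ Y.card * (Z.card : ℝ) ^ l * (Real.cosh s ^ Λ.card + Real.exp s ^ Λ.card / 3 ^ l) := by
  classical
  set c : (AddChar G ℂ → ℤ) → ℂ := fun m => ∏ χ, rieszCoeff Λ w s χ (m χ) with hc
  have hzero : (0 : AddChar G ℂ → ℤ) ∈ signVectors Λ := mem_signVectors.2 ⟨by simp, by simp⟩
  have hc0 : c 0 = ((Real.cosh s ^ Λ.card : ℝ) : ℂ) := by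
    simp only [hc, rieszCoeff, Pi.zero_apply, if_true]
    rw [Finset.prod_ite_mem, Finset.univ_inter, Finset.prod_const]
    push_cast; rfl
  have hexpand : ((∑ z ∈ Fintype.piFinset fun _ : Fin l => Z, ∑ y ∈ Y,
        ∏ χ ∈ Λ, (Real.cosh s + Real.sinh s * (w χ * χ (y + ∑ i, z i)).re) : ℝ) : ℂ)
      = ∑ m ∈ signVectors Λ, c m *
        ((∑ y ∈ Y, (∑ χ, m χ • χ) y) * (∑ x ∈ Z, (∑ χ, m χ • χ) x) ^ l) := by
    rw [Complex.ofReal_sum]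
    simp only [Complex.ofReal_sum Y, prod_riesz_eq, ← sum_addChar_add_sum, Finset.mul_sum, hc]
    rw [Finset.sum_comm]
    refine (Finset.sum_congr rfl fun y _ => Finset.sum_comm).trans ?_
    rw [Finset.sum_comm]
    exact Finset.sum_congr rfl fun m _ => Finset.sum_comm
  have hYle : ∀ χ : AddChar G ℂ, ‖∑ y ∈ Y, χ y‖ ≤ Y.card := fun χ => by
    refine (norm_sum_le _ _).trans_eq ?_
    simp [χ.norm_apply]
  have hterm : ∀ m ∈ signVectors Λ, ‖c m *
        ((∑ y ∈ Y, (∑ χ, m χ • χ) y) * (∑ x ∈ Z, (∑ χ, m χ • χ) x) ^ l)‖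
      ≤ Y.card * (Z.card : ℝ) ^ l *
        ((if m = 0 then Real.cosh s ^ Λ.card else 0) + ‖c m‖ / 3 ^ l) := by
    intro m hm
    rw [norm_mul, norm_mul, norm_pow]
    split_ifs with h0
    · subst h0
      have h1 : ‖c 0‖ = Real.cosh s ^ Λ.card := by
        rw [hc0, Complex.norm_real, Real.norm_of_nonneg (by have := Real.cosh_pos s; positivity)]
      have h2 : ‖∑ y ∈ Y, (∑ χ : AddChar G ℂ, (0 : AddChar G ℂ → ℤ) χ • χ) y‖ = Y.card := by simp
      have h3 : ‖∑ y ∈ Z, (∑ χ : AddChar G ℂ, (0 : AddChar G ℂ → ℤ) χ • χ) y‖ = Z.card := by simp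
      rw [h2, h3, h1]
      have := Real.cosh_pos s
      rw [mul_add, mul_comm (Real.cosh s ^ Λ.card)]
      exact le_add_of_nonneg_right (by positivity)
    · rw [zero_add]
      have h1 := hΛ m hm h0
      calc _ ≤ ‖c m‖ * (Y.card * ((Z.card : ℝ) / 3) ^ l) := by
            gcongr
            exact hYle _
        _ = _ := by rw [div_pow]; ring
  have hnorm := congrArg norm hexpand
  rw [Complex.norm_real] at hnorm
  refine (Real.le_norm_self _).trans (hnorm.trans_le ?_)
  refine (norm_sum_le _ _).trans ((Finset.sum_le_sum hterm).trans_eq ?_)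
  rw [← Finset.mul_sum, Finset.sum_add_distrib, Finset.sum_ite_eq' _ _ _, if_pos hzero,
    ← Finset.sum_div, sum_norm_rieszCoeff Λ w hw hs]

theorem exp_mul_le_cosh_add {s u : ℝ} (hu : |u| ≤ 1) :
    Real.exp (s * u) ≤ Real.cosh s + Real.sinh s * u := by
  obtain ⟨h1, h2⟩ := abs_le.1 hu
  have h := convexOn_exp.2 (Set.mem_univ s) (Set.mem_univ (-s))
    (by linarith : 0 ≤ (1 + u) / 2) (by linarith : 0 ≤ (1 - u) / 2) (by ring)
  rw [smul_eq_mul, smul_eq_mul, smul_eq_mul, smul_eq_mul] at h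
  rw [Real.cosh_eq, Real.sinh_eq]
  refine le_trans (le_of_eq (by congr 1; ring)) (h.trans_eq (by ring))

/-- The counting step of Chang's theorem. If the sums of `T` at all characters of a dissociated set
`Λ` are large, then `∑ exp (s ∑ Re (w χ))` is exponentially large on `T`, whereas the Riesz product
bounds it on `B ⊇ T`; the set `Y` is an enlargement of `B` that absorbs `l`-fold sums from `Z`. -/
theorem card_mul_exp_le_of_dissociated {B Y Z T : Finset G} {l : ℕ} (hTB : T ⊆ B)
    (hZ : Z.Nonempty) (hY : ∀ x ∈ B, ∀ z : Fin l → G, (∀ i, z i ∈ Z) → x - ∑ i, z i ∈ Y)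
    {Λ : Finset (AddChar G ℂ)} (hΛ : IsDissociatedOn Z Λ) (hcard : Λ.card ≤ l)
    (hT : ∀ χ ∈ Λ, (T.card : ℝ) / 2 ≤ ‖∑ x ∈ T, χ x‖) :
    (T.card : ℝ) * Real.exp (Λ.card / 8) ≤ 2 * Y.card := by
  classical
  set n := Λ.card with hn
  have hw : ∀ χ : AddChar G ℂ, ∃ w : ℂ, ‖w‖ = 1 ∧ w * ∑ x ∈ T, χ x = ‖∑ x ∈ T, χ x‖ := by
    intro χ
    by_cases h0 : ∑ x ∈ T, χ x = 0
    · exact ⟨1, by simp, by simp [h0]⟩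
    · have hne : (‖∑ x ∈ T, χ x‖ : ℂ) ≠ 0 := by simpa using h0
      refine ⟨(starRingEnd ℂ) (∑ x ∈ T, χ x) / ‖∑ x ∈ T, χ x‖, ?_, ?_⟩
      · rw [norm_div, RCLike.norm_conj, Complex.norm_real, norm_norm, div_self]
        simpa using h0
      · rw [div_mul_eq_mul_div, mul_comm, Complex.mul_conj, Complex.normSq_eq_norm_sq,
          div_eq_iff hne]
        push_cast; ring
  choose w hw1 hw2 using hw
  set u : G → ℝ := fun x => ∑ χ ∈ Λ, (w χ * χ x).re with hu
  have husum : (n : ℝ) / 2 * T.card ≤ ∑ x ∈ T, u x := by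
    have h1 : ∑ x ∈ T, u x = ∑ χ ∈ Λ, ‖∑ x ∈ T, χ x‖ := by
      rw [hu, Finset.sum_comm]
      refine Finset.sum_congr rfl fun χ _ => ?_
      rw [← Complex.re_sum, ← Finset.mul_sum, hw2, Complex.ofReal_re]
    rw [h1]
    have := Finset.card_nsmul_le_sum Λ (fun χ => ‖∑ x ∈ T, χ x‖) _ hT
    rw [nsmul_eq_mul] at this
    refine le_trans (le_of_eq ?_) this
    rw [hn]; ring
  have hlower : (T.card : ℝ) * Real.exp (n / 4) ≤ ∑ x ∈ T, Real.exp (1 / 2 * u x) := by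
    have h1 : ∀ x ∈ T, Real.exp (n / 4) * (1 + (1 / 2 * u x - n / 4)) ≤ Real.exp (1 / 2 * u x) := by
      intro x _
      have := Real.add_one_le_exp (1 / 2 * u x - n / 4)
      calc _ ≤ Real.exp (n / 4) * Real.exp (1 / 2 * u x - n / 4) := by gcongr; linarith
        _ = _ := by rw [← Real.exp_add]; congr 1; ring
    refine le_trans ?_ (Finset.sum_le_sum h1)
    rw [← Finset.mul_sum, Finset.sum_add_distrib, Finset.sum_sub_distrib, ← Finset.mul_sum]
    simp only [Finset.sum_const, nsmul_eq_mul, mul_one]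
    rw [mul_comm]
    gcongr
    linarith
  set R : G → ℝ := fun x =>
    ∏ χ ∈ Λ, (Real.cosh (1 / 2) + Real.sinh (1 / 2) * (w χ * χ x).re) with hR
  have hunit : ∀ χ : AddChar G ℂ, ∀ x, |(w χ * χ x).re| ≤ 1 := fun χ x =>
    (Complex.abs_re_le_norm _).trans_eq (by rw [norm_mul, hw1, χ.norm_apply, one_mul])
  have hexpR : ∀ x, Real.exp (1 / 2 * u x) ≤ R x := by
    intro x
    rw [hu, Finset.mul_sum, Real.exp_sum]
    exact Finset.prod_le_prod (fun _ _ => (Real.exp_pos _).le)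
      fun χ _ => exp_mul_le_cosh_add (hunit χ x)
  have hRpos : ∀ x, 0 ≤ R x := fun x => (Real.exp_pos _).le.trans (hexpR x)
  have hdom : (Z.card : ℝ) ^ l * ∑ x ∈ B, R x ≤
      ∑ z ∈ Fintype.piFinset fun _ : Fin l => Z, ∑ y ∈ Y, R (y + ∑ i, z i) := by
    have h1 : ∀ z ∈ Fintype.piFinset fun _ : Fin l => Z,
        ∑ x ∈ B, R x ≤ ∑ y ∈ Y, R (y + ∑ i, z i) := by
      intro z hz
      have h2 : ∑ x ∈ B, R x
          = ∑ y ∈ B.image (fun x => x - ∑ i, z i), R (y + ∑ i, z i) := by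
        rw [Finset.sum_image fun a _ b _ h => sub_left_injective h]
        simp
      rw [h2]
      refine Finset.sum_le_sum_of_subset_of_nonneg (fun y hy => ?_) fun _ _ _ => hRpos _
      obtain ⟨x, hx, rfl⟩ := Finset.mem_image.1 hy
      exact hY x hx z fun i => Fintype.mem_piFinset.1 hz i
    have := Finset.card_nsmul_le_sum _ _ _ h1
    rwa [Fintype.card_piFinset_const, nsmul_eq_mul, Nat.cast_pow] at this
  have hriesz := sum_riesz_le Y Z l hΛ w hw1 (by norm_num : (0 : ℝ) ≤ 1 / 2)
  have hZl : (0 : ℝ) < (Z.card : ℝ) ^ l := by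
    have : (0 : ℝ) < Z.card := by exact_mod_cast hZ.card_pos
    positivity
  have hcosh : Real.cosh (1 / 2) ^ n ≤ Real.exp (n / 8) := by
    have h1 := Real.cosh_le_exp_half_sq (1 / 2)
    calc _ ≤ Real.exp ((1 / 2) ^ 2 / 2) ^ n :=
          pow_le_pow_left₀ (Real.cosh_pos _).le h1 n
      _ = _ := by rw [← Real.exp_nat_mul]; congr 1; ring
  have hthree : Real.exp (1 / 2) ^ n / 3 ^ l ≤ 1 := by
    rw [div_le_one (by positivity)]
    have h1 : Real.exp (1 / 2) ≤ 3 := by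
      refine (Real.exp_le_exp.2 (by norm_num : (1 / 2 : ℝ) ≤ 1)).trans ?_
      exact Real.exp_one_lt_d9.le.trans (by norm_num)
    calc _ ≤ (3 : ℝ) ^ n := pow_le_pow_left₀ (Real.exp_pos _).le h1 n
      _ ≤ 3 ^ l := pow_le_pow_right₀ (by norm_num) hcard
  have hone : (1 : ℝ) ≤ Real.exp (n / 8) := Real.one_le_exp (by positivity)
  have hup : ∑ x ∈ B, R x ≤ Y.card * (2 * Real.exp (n / 8)) := by
    refine le_of_mul_le_mul_left ?_ hZl
    calc _ ≤ _ := hdom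
      _ ≤ _ := hriesz
      _ ≤ Y.card * (Z.card : ℝ) ^ l * (2 * Real.exp (n / 8)) := by gcongr; linarith
      _ = _ := by ring
  have hfin : (T.card : ℝ) * Real.exp (n / 4) ≤ Y.card * (2 * Real.exp (n / 8)) := by
    refine hlower.trans ((Finset.sum_le_sum fun x _ => hexpR x).trans ?_)
    exact (Finset.sum_le_sum_of_subset_of_nonneg hTB fun _ _ _ => hRpos _).trans hup
  have hsplit : Real.exp ((n : ℝ) / 4) = Real.exp (n / 8) * Real.exp (n / 8) := by
    rw [← Real.exp_add]; congr 1; ring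
  rw [hsplit] at hfin
  refine le_of_mul_le_mul_right ?_ (Real.exp_pos ((n : ℝ) / 8))
  linarith

end Chang

/-! ### Chang's theorem relative to a regular Bohr set -/

section RelativeChang

variable {G : Type*} [AddCommGroup G] [Fintype G]

/-- If `Λ ⊆ Spec` is dissociated but adding `γ` destroys this, then `γ` differs from a
`{-1, 0, 1}`-combination of `Λ` by a character that correlates with `Z`. -/
theorem norm_sub_one_le_of_not_dissociated {Z : Finset G} {Λ : Finset (AddChar G ℂ)}
    (hΛ : IsDissociatedOn Z Λ) {γ : AddChar G ℂ} (hγ : ¬ IsDissociatedOn Z (insert γ Λ))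
    {t : G} {δ ν : ℝ} (hδ : ∀ χ ∈ Λ, ‖χ t - 1‖ ≤ δ)
    (hν : ∀ χ : AddChar G ℂ, (Z.card : ℝ) / 3 ≤ ‖∑ x ∈ Z, χ x‖ → ‖χ t - 1‖ ≤ ν) :
    ‖γ t - 1‖ ≤ ν + Λ.card * δ := by
  classical
  rw [IsDissociatedOn] at hγ
  push Not at hγ
  obtain ⟨m, hm, hm0, hlt⟩ := hγ
  obtain ⟨hm1, hm2⟩ := mem_signVectors.1 hm
  have hmγ : m γ ≠ 0 := by
    intro h0
    refine hlt.not_ge (hΛ m (mem_signVectors.2 ⟨hm1, fun χ hχ => ?_⟩) hm0)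
    by_cases h : χ = γ
    · rw [h, h0]
    · exact hm2 χ (by simp [h, hχ])
  have hsum : ∑ χ, m χ • χ = m γ • γ + ∑ χ ∈ Λ.erase γ, m χ • χ := by
    have h1 : ∑ χ, m χ • χ = ∑ χ ∈ insert γ Λ, m χ • χ := by
      refine (Finset.sum_subset (Finset.subset_univ _) fun χ _ hχ => ?_).symm
      rw [hm2 χ hχ, zero_zsmul]
    rw [h1, ← Finset.add_sum_erase _ _ (Finset.mem_insert_self γ Λ), Finset.erase_insert_eq_erase]
  have hmain := hν _ hlt.le
  have hrest : ‖(∑ χ ∈ Λ.erase γ, (-m χ) • χ) t - 1‖ ≤ Λ.card * δ := by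
    have hδ0 : ∀ χ ∈ Λ, 0 ≤ δ := fun χ hχ => (norm_nonneg _).trans (hδ χ hχ)
    refine (norm_sum_addChar_sub_one_le _ _ t).trans ?_
    refine (Finset.sum_le_sum_of_subset_of_nonneg (Finset.erase_subset _ _)
      fun _ _ _ => norm_nonneg _).trans ?_
    rw [← nsmul_eq_mul]
    refine Finset.sum_le_card_nsmul _ _ _ fun χ hχ => ?_
    refine (norm_zsmul_addChar_sub_one_le ?_ χ t).trans (hδ χ hχ)
    have := Finset.mem_Icc.1 (hm1 χ)
    exact Finset.mem_Icc.2 ⟨by omega, by omega⟩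
  have heq : m γ • γ = (∑ χ, m χ • χ) + ∑ χ ∈ Λ.erase γ, (-m χ) • χ := by
    rw [hsum]
    simp only [neg_smul, Finset.sum_neg_distrib]
    abel
  have hboth : ‖(m γ • γ) t - 1‖ ≤ ν + Λ.card * δ := by
    have h := norm_addChar_add_sub_one_le (AddChar.doubleDualEmb t : AddChar (AddChar G ℂ) ℂ)
      (∑ χ, m χ • χ) (∑ χ ∈ Λ.erase γ, (-m χ) • χ)
    rw [← heq] at h
    simp only [AddChar.doubleDualEmb_apply] at h
    exact h.trans (add_le_add hmain hrest)
  have hback : γ = m γ • (m γ • γ) := by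
    have := Finset.mem_Icc.1 (hm1 γ)
    have h1 : m γ = 1 ∨ m γ = -1 := by omega
    rcases h1 with h1 | h1 <;> simp [h1]
  rw [hback]
  exact (norm_zsmul_addChar_sub_one_le (hm1 γ) (m γ • γ) t).trans hboth

/-- Chang's theorem relative to a regular Bohr set: the characters with a large mean over
`T ⊆ B(K, ρ)` become nearly trivial on a Bohr set with `O(log (|B| / |T|))` further frequencies.
The numerical constants come from `|Y| ≤ 3/2 |B|` for the enlargement `Y = B(K, ρ (1 + 1/(200 r)))`,
from `Z = B(K, ρ₁)` with `l ρ₁ ≤ ρ / (200 r)`, and from the regularity of `Z`. -/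
theorem exists_annihilating_frequencies (K : Finset (AddChar G ℂ)) {ρ : ℝ} (hρ : 0 < ρ)
    (hρ1 : ρ ≤ 1) (hreg : IsRegularBohr K ρ) {T : Finset G} (hTB : T ⊆ bohrSet K ρ)
    (hT : T.Nonempty) {l : ℕ} (hl : 8 * Real.log (3 * (bohrSet K ρ).card / T.card) < l) :
    ∃ Λ : Finset (AddChar G ℂ), Λ.card ≤ l ∧ ∀ ν : ℝ, 0 < ν → ν ≤ 1 →
      ∀ t ∈ bohrSet (K ∪ Λ) (ρ * ν / (480000 * max 1 (K.card : ℝ) ^ 2 * l)),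
      ∀ γ : AddChar G ℂ, (T.card : ℝ) / 2 ≤ ‖∑ x ∈ T, γ x‖ → ‖γ t - 1‖ ≤ ν := by
  classical
  set r : ℝ := max 1 (K.card : ℝ) with hr
  have hr1 : 1 ≤ r := le_max_left _ _
  set B := bohrSet K ρ with hB
  have hT0 : (0 : ℝ) < T.card := by exact_mod_cast hT.card_pos
  have hTB' : (T.card : ℝ) ≤ B.card := by exact_mod_cast Finset.card_le_card hTB
  have hl0 : (1 : ℝ) ≤ l := by
    have h1 : 0 < Real.log (3 * B.card / T.card) := by
      refine Real.log_pos ?_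
      rw [lt_div_iff₀ hT0]
      linarith
    have h2 : (0 : ℝ) < l := by linarith
    exact_mod_cast h2
  set ε : ℝ := 1 / (200 * r) with hε
  have hε0 : 0 < ε := by positivity
  have hεr : 100 * r * ε = 1 / 2 := by rw [hε]; field_simp; norm_num
  obtain ⟨ρ₁, hρ₁low, hρ₁up, hreg₁⟩ := exists_isRegularBohr K
    (by positivity : 0 < ε * ρ / l)
  have hρ₁ : 0 < ρ₁ := lt_of_lt_of_le (by positivity) hρ₁low
  set Z := bohrSet K ρ₁ with hZ
  set Y := bohrSet K (ρ * (1 + ε)) with hY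
  have hZne : Z.Nonempty := ⟨0, zero_mem_bohrSet K hρ₁.le⟩
  have hYcard : (Y.card : ℝ) ≤ 3 / 2 * B.card := by
    have := hreg.card_le hε0 (by rw [← hr, hεr]; norm_num)
    rw [← hr, hεr] at this
    linarith
  have hYmem : ∀ x ∈ B, ∀ z : Fin l → G, (∀ i, z i ∈ Z) → x - ∑ i, z i ∈ Y := by
    intro x hx z hz
    have hsum : ∑ i, z i ∈ bohrSet K (ρ * ε) := by
      refine mem_bohrSet.2 fun γ hγ => (norm_addChar_sum_sub_one_le γ _ z).trans ?_
      refine (Finset.sum_le_card_nsmul _ _ ρ₁ fun i _ => mem_bohrSet.1 (hz i) γ hγ).trans ?_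
      rw [Finset.card_univ, Fintype.card_fin, nsmul_eq_mul]
      rw [le_div_iff₀ (by linarith)] at hρ₁up
      linarith
    rw [sub_eq_add_neg, hY, show ρ * (1 + ε) = ρ + ρ * ε by ring]
    exact add_mem_bohrSet hx (neg_mem_bohrSet hsum)
  set spec : Finset (AddChar G ℂ) :=
    Finset.univ.filter fun γ => (T.card : ℝ) / 2 ≤ ‖∑ x ∈ T, γ x‖ with hspec
  have hsmall : ∀ Λ ⊆ spec, IsDissociatedOn Z Λ → Λ.card ≤ l := by
    intro Λ hΛ hdis
    by_contra! hlt
    obtain ⟨Λ', hΛ', hcard⟩ := Finset.exists_subset_card_eq hlt.le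
    have h := card_mul_exp_le_of_dissociated hTB hZne hYmem (hdis.mono hΛ') hcard.le
      fun χ hχ => (Finset.mem_filter.1 (hΛ (hΛ' hχ))).2
    rw [hcard] at h
    have h2 : Real.exp ((l : ℝ) / 8) ≤ 3 * B.card / T.card := by
      rw [le_div_iff₀ hT0]
      linarith
    rw [← Real.le_log_iff_exp_le (lt_of_lt_of_le (Real.exp_pos _) h2)] at h2
    linarith
  obtain ⟨Λ, hΛmem, hmax⟩ := Finset.exists_max_image
    (spec.powerset.filter fun Λ => IsDissociatedOn Z Λ) Finset.card
    ⟨∅, Finset.mem_filter.2 ⟨Finset.empty_mem_powerset _, fun m hm hm0 => by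
      exact absurd (funext fun χ => (mem_signVectors.1 hm).2 χ (Finset.notMem_empty χ)) hm0⟩⟩
  rw [Finset.mem_filter, Finset.mem_powerset] at hΛmem
  have hΛcard := hsmall Λ hΛmem.1 hΛmem.2
  refine ⟨Λ, hΛcard, fun ν hν hν1 t ht γ hγ => ?_⟩
  set δ : ℝ := ρ * ν / (480000 * r ^ 2 * l) with hδ
  have hδ0 : 0 < δ := by positivity
  have hlδ : l * δ ≤ ν / 2 := by
    have h1 : l * δ = ρ * ν / (480000 * r ^ 2) := by rw [hδ]; field_simp
    rw [h1, div_le_div_iff₀ (by positivity) (by norm_num)]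
    nlinarith [mul_le_mul_of_nonneg_right hρ1 hν.le,
      mul_le_mul_of_nonneg_left (one_le_pow₀ hr1 : 1 ≤ r ^ 2) hν.le]
  have hδν : δ ≤ ν / 2 := (le_mul_of_one_le_left hδ0.le hl0).trans hlδ
  have htΛ : ∀ χ ∈ Λ, ‖χ t - 1‖ ≤ δ := fun χ hχ =>
    mem_bohrSet.1 ht χ (Finset.mem_union_right _ hχ)
  by_cases hγΛ : γ ∈ Λ
  · linarith [htΛ γ hγΛ]
  have hnot : ¬ IsDissociatedOn Z (insert γ Λ) := by
    intro hdis
    have := hmax (insert γ Λ) (Finset.mem_filter.2 ⟨Finset.mem_powerset.2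
      (Finset.insert_subset (Finset.mem_filter.2 ⟨Finset.mem_univ _, hγ⟩) hΛmem.1), hdis⟩)
    rw [Finset.card_insert_of_notMem hγΛ] at this
    omega
  set ε' : ℝ := ν / (1200 * r) with hε'
  have hε'0 : 0 < ε' := by positivity
  have hε'r : r * ε' = ν / 1200 := by rw [hε']; field_simp
  have htZ : t ∈ bohrSet K (ρ₁ * ε') := by
    refine bohrSet_mono Finset.subset_union_left ?_ ht
    calc δ = ε * ρ / l / 2 * ε' := by rw [hδ, hε, hε']; field_simp; norm_num
      _ ≤ ρ₁ * ε' := by gcongr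
  have hspecZ : ∀ χ : AddChar G ℂ, (Z.card : ℝ) / 3 ≤ ‖∑ x ∈ Z, χ x‖ → ‖χ t - 1‖ ≤ ν / 2 := by
    intro χ hχ
    have h1 := hreg₁.norm_sub_one_mul_le hε'0 (by rw [← hr, mul_assoc, hε'r]; linarith) χ htZ
    rw [← hr, mul_assoc 200 r, hε'r] at h1
    have hZ0 : (0 : ℝ) < Z.card := by exact_mod_cast hZne.card_pos
    have h2 : ‖χ t - 1‖ * (Z.card / 3) ≤ 200 * (ν / 1200) * Z.card :=
      (mul_le_mul_of_nonneg_left hχ (norm_nonneg _)).trans h1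
    refine le_of_mul_le_mul_right ?_ hZ0
    linarith
  have := norm_sub_one_le_of_not_dissociated hΛmem.2 hnot htΛ hspecZ
  have h3 : (Λ.card : ℝ) * δ ≤ l * δ := by
    gcongr
  linarith

end RelativeChang

/-! ### From almost periods to a Bohr set -/

section Spectral

variable {G : Type*} [AddCommGroup G]

/-- The Fourier coefficients of `selfOverlap A`. -/
noncomputable def overlapWeight [Fintype G] (A : Finset G) (γ : AddChar G ℂ) : ℝ :=
  ‖∑ a ∈ A, γ a‖ ^ 2 / (Fintype.card G * A.card)

theorem ofReal_norm_sum_sq [Fintype G] (A : Finset G) (γ : AddChar G ℂ) :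
    ((‖∑ a ∈ A, γ a‖ ^ 2 : ℝ) : ℂ) = ∑ a ∈ A, ∑ b ∈ A, γ (b - a) := by
  rw [← Complex.normSq_eq_norm_sq, ← Complex.mul_conj, map_sum, mul_comm, Finset.sum_mul]
  refine Finset.sum_congr rfl fun a _ => ?_
  rw [Finset.mul_sum]
  refine Finset.sum_congr rfl fun b _ => ?_
  rw [sub_eq_add_neg, γ.map_add_eq_mul, AddChar.map_neg_eq_conj, mul_comm]

theorem selfOverlap_eq_sum [Fintype G] [DecidableEq G] (A : Finset G) (x : G) :
    (selfOverlap A x : ℂ) = ∑ γ, (overlapWeight A γ : ℂ) * γ x := by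
  have hN : (Fintype.card G : ℂ) ≠ 0 := by exact_mod_cast Fintype.card_ne_zero
  have h1 : ∑ γ : AddChar G ℂ, ((‖∑ a ∈ A, γ a‖ ^ 2 : ℝ) : ℂ) * γ x
      = Fintype.card G * ((A ∩ (x +ᵥ A)).card : ℂ) := by
    simp only [ofReal_norm_sum_sq, Finset.sum_mul, ← AddChar.map_add_eq_mul]
    rw [Finset.sum_comm]
    have h2 : ∀ a ∈ A, ∑ γ : AddChar G ℂ, ∑ b ∈ A, γ (b - a + x)
        = if a ∈ x +ᵥ A then (Fintype.card G : ℂ) else 0 := by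
      intro a _
      rw [Finset.sum_comm]
      simp only [AddChar.sum_apply_eq_ite]
      have h3 : ∀ b : G, b - a + x = 0 ↔ b = -x +ᵥ a := fun b => by
        rw [vadd_eq_add, ← sub_eq_zero (a := b)]
        constructor <;> intro h <;> rw [← h] <;> abel
      simp only [h3, Finset.sum_ite_eq', Finset.neg_vadd_mem_iff]
    rw [Finset.sum_congr rfl h2, ← Finset.sum_filter, Finset.filter_mem_eq_inter,
      Finset.sum_const, nsmul_eq_mul, mul_comm]
  have h4 : ∑ γ, (overlapWeight A γ : ℂ) * γ x
      = (∑ γ : AddChar G ℂ, ((‖∑ a ∈ A, γ a‖ ^ 2 : ℝ) : ℂ) * γ x)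
        / (Fintype.card G * A.card) := by
    rw [Finset.sum_div]
    refine Finset.sum_congr rfl fun γ _ => ?_
    rw [overlapWeight]
    push_cast
    ring
  rw [h4, h1, selfOverlap]
  push_cast
  rw [mul_div_mul_left _ _ hN]

theorem sum_overlapWeight [Fintype G] [DecidableEq G] {A : Finset G} (hA : A.Nonempty) :
    ∑ γ, overlapWeight A γ = 1 := by
  have h := selfOverlap_eq_sum A 0
  have hA0 : (A.card : ℝ) ≠ 0 := by exact_mod_cast hA.card_pos.ne'
  rw [selfOverlap, zero_vadd, Finset.inter_self, div_self hA0] at h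
  simp only [AddChar.map_zero_eq_one, mul_one] at h
  exact_mod_cast h.symm

/-- Averaging over the translations by differences of elements of `T`. -/
noncomputable def diffAverage (T : Finset G) (g : G → ℂ) (x : G) : ℂ :=
  (∑ s ∈ T, ∑ s' ∈ T, g (x + (s - s'))) / (T.card : ℂ) ^ 2

theorem norm_diffAverage_le {T : Finset G} (hT : T.Nonempty) {g : G → ℂ} {δ : ℝ} {x : G}
    (h : ∀ s ∈ T, ∀ s' ∈ T, ‖g (x + (s - s'))‖ ≤ δ) : ‖diffAverage T g x‖ ≤ δ := by
  have hT0 : (0 : ℝ) < T.card := by exact_mod_cast hT.card_pos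
  rw [diffAverage, norm_div, norm_pow, Complex.norm_natCast, div_le_iff₀ (by positivity)]
  refine (norm_sum_le _ _).trans ?_
  have h1 : ∀ s ∈ T, ‖∑ s' ∈ T, g (x + (s - s'))‖ ≤ T.card • δ := fun s hs =>
    (norm_sum_le _ _).trans (Finset.sum_le_card_nsmul _ _ _ (h s hs))
  refine (Finset.sum_le_card_nsmul _ _ _ h1).trans_eq ?_
  simp only [nsmul_eq_mul]
  ring

theorem norm_diffAverage_iterate_sub_le {T : Finset G} (hT : T.Nonempty) {g : G → ℂ} {δ : ℝ}
    (h : ∀ s ∈ T, ∀ s' ∈ T, ∀ x, ‖g (x + (s - s')) - g x‖ ≤ δ) (L : ℕ) (x : G) :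
    ‖(diffAverage T)^[L] g x - g x‖ ≤ L * δ := by
  have hT0 : (T.card : ℂ) ≠ 0 := by exact_mod_cast hT.card_pos.ne'
  have hsub : ∀ f : G → ℂ, ∀ v x, diffAverage T (fun y => f (y + v) - f y) x
      = diffAverage T f (x + v) - diffAverage T f x := by
    intro f v x
    simp only [diffAverage, Finset.sum_sub_distrib, sub_div]
    simp only [add_right_comm x v]
  have hconst : ∀ f : G → ℂ, ∀ x, diffAverage T (fun y => f y - f x) x
      = diffAverage T f x - f x := by
    intro f x
    simp only [diffAverage, Finset.sum_sub_distrib, sub_div, Finset.sum_const, nsmul_eq_mul]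
    congr 1
    field_simp
  -- every iterate has the same almost periods as `g`
  have hstep : ∀ L : ℕ, ∀ s ∈ T, ∀ s' ∈ T, ∀ x,
      ‖(diffAverage T)^[L] g (x + (s - s')) - (diffAverage T)^[L] g x‖ ≤ δ := by
    intro L
    induction L with
    | zero => exact h
    | succ L ih =>
      intro s hs s' hs' x
      rw [Function.iterate_succ_apply', ← hsub]
      exact norm_diffAverage_le hT fun u _ u' _ => ih s hs s' hs' _
  induction L with
  | zero => simp
  | succ L ih =>
    have h1 : ‖(diffAverage T)^[L + 1] g x - (diffAverage T)^[L] g x‖ ≤ δ := by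
      rw [Function.iterate_succ_apply', ← hconst]
      exact norm_diffAverage_le hT fun u hu u' hu' => hstep L u hu u' hu' x
    have := norm_sub_le_norm_sub_add_norm_sub ((diffAverage T)^[L + 1] g x)
      ((diffAverage T)^[L] g x) (g x)
    push_cast
    linarith

theorem diffAverage_iterate_sum [Fintype G] (T : Finset G) (a : AddChar G ℂ → ℂ) (L : ℕ) :
    (diffAverage T)^[L] (fun x => ∑ γ, a γ * γ x)
      = fun x => ∑ γ, a γ * (((‖∑ s ∈ T, γ s‖ ^ 2 / (T.card : ℝ) ^ 2) ^ L : ℝ) : ℂ) * γ x := by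
  induction L with
  | zero => simp
  | succ L ih =>
    rw [Function.iterate_succ_apply', ih]
    funext x
    have h1 : ∀ γ : AddChar G ℂ, (∑ s ∈ T, ∑ s' ∈ T, γ (x + (s - s'))) / (T.card : ℂ) ^ 2
        = ((‖∑ s ∈ T, γ s‖ ^ 2 / (T.card : ℝ) ^ 2 : ℝ) : ℂ) * γ x := by
      intro γ
      rw [Complex.ofReal_div, ofReal_norm_sum_sq, Finset.sum_comm]
      simp only [γ.map_add_eq_mul x, ← Finset.mul_sum]
      push_cast
      ring
    simp only [diffAverage]
    rw [show ∑ s ∈ T, ∑ s' ∈ T, ∑ γ : AddChar G ℂ,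
        a γ * (((‖∑ s ∈ T, γ s‖ ^ 2 / (T.card : ℝ) ^ 2) ^ L : ℝ) : ℂ) * γ (x + (s - s'))
        = ∑ γ : AddChar G ℂ, a γ * (((‖∑ s ∈ T, γ s‖ ^ 2 / (T.card : ℝ) ^ 2) ^ L : ℝ) : ℂ)
          * ∑ s ∈ T, ∑ s' ∈ T, γ (x + (s - s')) from ?_]
    · rw [Finset.sum_div]
      refine Finset.sum_congr rfl fun γ _ => ?_
      rw [mul_div_assoc, h1, pow_succ]
      push_cast
      ring
    · simp only [Finset.mul_sum]
      rw [Finset.sum_comm (s := Finset.univ) (t := T)]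
      refine Finset.sum_congr rfl fun s _ => ?_
      rw [Finset.sum_comm]

/-- Almost periods in `T - T` spread to every `t` at which the large spectrum of `T` is nearly
trivial: averaging `L` times over `T - T` costs `L δ` and damps all other frequencies by `4⁻ᴸ`,
while the Fourier coefficients of `selfOverlap A` are non-negative with sum `1`. -/
theorem abs_selfOverlap_sub_le [Fintype G] [DecidableEq G] {A T : Finset G} (hA : A.Nonempty)
    (hT : T.Nonempty) {δ ν : ℝ}
    (hper : ∀ s ∈ T, ∀ s' ∈ T, ∀ x, |selfOverlap A (x + (s - s')) - selfOverlap A x| ≤ δ)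
    (L : ℕ) (hL : 2 / 4 ^ L ≤ ν) {t : G}
    (ht : ∀ γ : AddChar G ℂ, (T.card : ℝ) / 2 ≤ ‖∑ x ∈ T, γ x‖ → ‖γ t - 1‖ ≤ ν) (x : G) :
    |selfOverlap A (x + t) - selfOverlap A x| ≤ 2 * (L * δ) + ν := by
  have hT0 : (0 : ℝ) < T.card := by exact_mod_cast hT.card_pos
  set f : G → ℂ := fun x => (selfOverlap A x : ℂ) with hf
  set F : G → ℂ := (diffAverage T)^[L] f with hF
  have hclose : ∀ x, ‖F x - f x‖ ≤ L * δ := by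
    refine norm_diffAverage_iterate_sub_le hT (fun s hs s' hs' x => ?_) L
    rw [hf, ← Complex.ofReal_sub, Complex.norm_real]
    exact hper s hs s' hs' x
  have hFeq : F = fun x => ∑ γ, (overlapWeight A γ : ℂ)
      * (((‖∑ s ∈ T, γ s‖ ^ 2 / (T.card : ℝ) ^ 2) ^ L : ℝ) : ℂ) * γ x := by
    rw [hF, ← diffAverage_iterate_sum]
    congr 1
    funext x
    exact selfOverlap_eq_sum A x
  have hc : ∀ γ : AddChar G ℂ,
      (‖∑ s ∈ T, γ s‖ ^ 2 / (T.card : ℝ) ^ 2) ^ L * ‖γ t - 1‖ ≤ ν := by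
    intro γ
    have hle : ‖∑ s ∈ T, γ s‖ ≤ T.card := by
      refine (norm_sum_le _ _).trans_eq ?_
      simp [γ.norm_apply]
    rcases le_or_gt ((T.card : ℝ) / 2) ‖∑ x ∈ T, γ x‖ with h | h
    · have h1 : (‖∑ s ∈ T, γ s‖ ^ 2 / (T.card : ℝ) ^ 2) ^ L ≤ 1 := by
        refine pow_le_one₀ (by positivity) ?_
        rw [div_le_one (by positivity)]
        gcongr
      exact (mul_le_of_le_one_left (norm_nonneg _) h1).trans (ht γ h)
    · have h1 : ‖∑ s ∈ T, γ s‖ ^ 2 / (T.card : ℝ) ^ 2 ≤ 1 / 4 := by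
        rw [div_le_iff₀ (by positivity)]
        calc _ ≤ ((T.card : ℝ) / 2) ^ 2 := by gcongr
          _ = _ := by ring
      have h2 : ‖γ t - 1‖ ≤ 2 := by
        refine (norm_sub_le _ _).trans_eq ?_
        rw [γ.norm_apply, norm_one]; norm_num
      calc _ ≤ (1 / 4 : ℝ) ^ L * 2 := by gcongr
        _ = 2 / 4 ^ L := by rw [one_div, inv_pow]; ring
        _ ≤ ν := hL
  have hFdiff : ‖F (x + t) - F x‖ ≤ ν := by
    rw [hFeq]
    simp only
    rw [← Finset.sum_sub_distrib]
    refine (norm_sum_le _ _).trans ?_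
    have h1 : ∀ γ ∈ (Finset.univ : Finset (AddChar G ℂ)), ‖(overlapWeight A γ : ℂ)
      * (((‖∑ s ∈ T, γ s‖ ^ 2 / (T.card : ℝ) ^ 2) ^ L : ℝ) : ℂ) * γ (x + t)
      - (overlapWeight A γ : ℂ)
      * (((‖∑ s ∈ T, γ s‖ ^ 2 / (T.card : ℝ) ^ 2) ^ L : ℝ) : ℂ) * γ x‖
      ≤ overlapWeight A γ * ν := by
      intro γ _
      have hw : 0 ≤ overlapWeight A γ := by rw [overlapWeight]; positivity
      rw [← mul_sub, γ.map_add_eq_mul, ← mul_sub_one, norm_mul, norm_mul, norm_mul, γ.norm_apply,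
        one_mul, Complex.norm_real, Complex.norm_real, Real.norm_of_nonneg hw,
        Real.norm_of_nonneg (by positivity), mul_assoc]
      exact mul_le_mul_of_nonneg_left (hc γ) hw
    refine (Finset.sum_le_sum h1).trans_eq ?_
    rw [← Finset.sum_mul, sum_overlapWeight hA, one_mul]
  have hfin : ‖f (x + t) - f x‖ ≤ 2 * (L * δ) + ν := by
    have h1 : f (x + t) - f x = (F (x + t) - F x) - (F (x + t) - f (x + t)) + (F x - f x) := by ring
    rw [h1]
    refine (norm_add_le _ _).trans ?_
    have h2 := norm_sub_le (F (x + t) - F x) (F (x + t) - f (x + t))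
    linarith [hclose x, hclose (x + t)]
  rw [hf] at hfin
  simp only at hfin
  rwa [← Complex.ofReal_sub, Complex.norm_real] at hfin

theorem normConv_charMeasure_indicatorFn [Fintype G] [DecidableEq G] (A : Finset G) (x : G) :
    normConv (charMeasure A) (indicatorFn (-A)) x = selfOverlap A x := by
  have hN : (Fintype.card G : ℂ) ≠ 0 := by exact_mod_cast Fintype.card_ne_zero
  have h1 : ∀ y : G, charMeasure A y * indicatorFn (-A) (x - y)
      = if y ∈ A ∩ (x +ᵥ A) then (Fintype.card G : ℂ) / A.card else 0 := by
    intro y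
    have h2 : y ∈ x +ᵥ A ↔ x - y ∈ -A := by
      rw [← Finset.neg_vadd_mem_iff, Finset.mem_neg', vadd_eq_add, neg_sub, sub_eq_neg_add]
    simp only [charMeasure, indicatorFn, Set.indicator_apply, Finset.mem_coe, Finset.mem_inter, h2]
    by_cases h3 : y ∈ A <;> by_cases h4 : x - y ∈ -A <;> simp [h3, h4]
  rw [normConv, Finset.expect_eq_sum_div_card]
  simp only [h1]
  rw [← Finset.sum_filter, Finset.filter_mem_eq_inter, Finset.univ_inter, Finset.sum_const,
    nsmul_eq_mul, Finset.card_univ, selfOverlap]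
  push_cast
  field_simp

end Spectral

/-! ### Relative almost periodicity -/

section Main

variable {G : Type*} [AddCommGroup G] [Fintype G] [DecidableEq G]

/-- VC-dimension zero leaves a single translate. -/
theorem selfOverlap_eq_one_of_vcDim_eq_zero {A : Finset G} (hA : A.Nonempty)
    (hvc : translateVCDim A = 0) (x : G) : selfOverlap A x = 1 := by
  have h1 : (Finset.univ.image fun g : G => g +ᵥ A).card ≤ 1 := by
    refine (Finset.card_le_card_shatterer _).trans (Finset.card_shatterer_le_sum_vcDim.trans ?_)
    rw [translateVCDim] at hvc
    rw [hvc, show (Finset.Iic 0 : Finset ℕ) = {0} from rfl, Finset.sum_singleton,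
      Nat.choose_zero_right]
  have h2 : x +ᵥ A = (0 : G) +ᵥ A := Finset.card_le_one.1 h1 _
    (Finset.mem_image_of_mem _ (Finset.mem_univ x)) _
    (Finset.mem_image_of_mem _ (Finset.mem_univ 0))
  have hA0 : (A.card : ℝ) ≠ 0 := by exact_mod_cast hA.card_pos.ne'
  rw [selfOverlap, h2, zero_vadd, Finset.inter_self, div_self hA0]

/-- Passing to a regular width. If `B(K, ρ)` is not regular, one of the `8 ^ |K|` pieces of `S`
translates into `B(K, ρ / 2)`; this is the source of the term `irregularRank K ρ`. -/
theorem exists_regular_relative_subset (K : Finset (AddChar G ℂ)) {ρ C : ℝ} (hρ : 0 < ρ)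
    (A : Finset G) {S : Finset G} (hS : S.Nonempty) (hSB : S ⊆ bohrSet K ρ)
    (hC : ((A + S).card : ℝ) ≤ C * A.card) :
    ∃ (ρ₁ : ℝ) (S₁ : Finset G), ρ / 2 ≤ ρ₁ ∧ ρ₁ ≤ ρ ∧ IsRegularBohr K ρ₁ ∧ S₁.Nonempty ∧
      S₁ ⊆ bohrSet K ρ₁ ∧ ((A + S₁).card : ℝ) ≤ C * A.card ∧
      Real.log ((bohrSet K ρ₁).card / S₁.card)
        ≤ Real.log ((bohrSet K ρ).card / S.card) + 3 * irregularRank K ρ := by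
  classical
  by_cases hreg : IsRegularBohr K ρ
  · exact ⟨ρ, S, by linarith, le_rfl, hreg, hS, hSB, hC, by simp [irregularRank, hreg]⟩
  obtain ⟨ρ₁, h1, h2, hreg₁⟩ := exists_isRegularBohr K hρ
  obtain ⟨S', hS'S, hcard, hdiff⟩ := exists_subset_sub_mem_bohrSet K (half_pos hρ)
    (by rwa [mul_div_cancel₀ ρ two_ne_zero] : S ⊆ bohrSet K (2 * (ρ / 2)))
  have hS0 : (0 : ℝ) < S.card := by exact_mod_cast hS.card_pos
  have hS'0 : (0 : ℝ) < S'.card := by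
    by_contra h
    have h3 : (8 : ℝ) ^ K.card * S'.card ≤ 0 :=
      mul_nonpos_of_nonneg_of_nonpos (by positivity) (not_lt.1 h)
    linarith
  have hS'ne : S'.Nonempty := Finset.card_pos.1 (by exact_mod_cast hS'0)
  obtain ⟨y, hy⟩ := hS'ne
  have hcardv : (-y +ᵥ S').card = S'.card := Finset.card_vadd_finset _ _
  refine ⟨ρ₁, -y +ᵥ S', h1, h2, hreg₁, ⟨0, ?_⟩, ?_, ?_, ?_⟩
  · rw [Finset.neg_vadd_mem_iff.symm, neg_neg, vadd_eq_add, add_zero]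
    exact hy
  · intro z hz
    obtain ⟨x, hx, rfl⟩ := Finset.mem_vadd_finset.1 hz
    rw [vadd_eq_add, neg_add_eq_sub]
    exact bohrSet_mono subset_rfl h1 (hdiff x hx y hy)
  · have h3 : A + (-y +ᵥ S') = -y +ᵥ (A + S') := add_vadd_comm _ _ _
    rw [h3, Finset.card_vadd_finset]
    refine le_trans ?_ hC
    exact_mod_cast Finset.card_le_card (Finset.add_subset_add_left hS'S)
  · have hB1 := card_bohrSet_pos K (by linarith : 0 ≤ ρ₁)
    have hB := card_bohrSet_pos K hρ.le
    have hBle : ((bohrSet K ρ₁).card : ℝ) ≤ (bohrSet K ρ).card := by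
      exact_mod_cast Finset.card_le_card (bohrSet_mono subset_rfl h2)
    have h3 : ((bohrSet K ρ₁).card : ℝ) / (-y +ᵥ S').card
        ≤ 8 ^ K.card * ((bohrSet K ρ).card / S.card) := by
      rw [hcardv, mul_div_assoc', div_le_div_iff₀ hS'0 hS0]
      calc _ ≤ ((bohrSet K ρ).card : ℝ) * (8 ^ K.card * S'.card) := by gcongr
        _ = _ := by ring
    have h4 : 0 < ((bohrSet K ρ₁).card : ℝ) / (-y +ᵥ S').card := by
      rw [hcardv]; positivity
    refine (Real.log_le_log h4 h3).trans ?_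
    rw [Real.log_mul (by positivity) (by positivity), Real.log_pow]
    have h8 : Real.log 8 ≤ 3 := by
      rw [show (8 : ℝ) = 2 ^ 3 by norm_num, Real.log_pow]
      push_cast
      linarith [Real.log_two_lt_d9]
    have h5 : irregularRank K ρ = K.card := by simp [irregularRank, hreg]
    have h6 : (0 : ℝ) ≤ K.card := by positivity
    rw [h5]
    nlinarith

/-- The number of averaging steps, the sample size and their numerical bounds: `L ≈ log (8 / η)`
steps with the accuracy `η / (8 L)` each. -/
theorem exists_steps_and_sample_size {η : ℝ} (hη : 0 < η) (hη1 : η ≤ 1) {d : ℕ} (hd : 1 ≤ d) :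
    ∃ L n : ℕ, 0 < L ∧ 2 / 4 ^ L ≤ η / 4 ∧ 36864 * (d : ℝ) ≤ (η / (8 * L)) ^ 2 * n ∧
      (n : ℝ) ≤ 120000000 * ((η ^ 2)⁻¹ * d * Real.log (2 / η) ^ 2) := by
  have hd0 : (1 : ℝ) ≤ d := by exact_mod_cast hd
  have hlog2 := Real.log_two_gt_d9
  have hlogη : Real.log (2 / η) = Real.log 2 - Real.log η :=
    Real.log_div (by norm_num) hη.ne'
  have hlogη0 : Real.log η ≤ 0 := Real.log_nonpos hη.le hη1
  set ℓ := Real.log (2 / η) with hℓ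
  have hlog8 : Real.log (8 / η) = 3 * Real.log 2 - Real.log η := by
    rw [Real.log_div (by norm_num) hη.ne', show (8 : ℝ) = 2 ^ 3 by norm_num, Real.log_pow]
    push_cast; ring
  have hlog8pos : 0 < Real.log (8 / η) := by linarith
  set L := ⌈Real.log (8 / η)⌉₊ with hL
  have hL0 : 0 < L := Nat.ceil_pos.2 hlog8pos
  have hL1 : (1 : ℝ) ≤ L := by exact_mod_cast hL0
  have hLup : (L : ℝ) ≤ 5 * ℓ := by
    have := Nat.ceil_lt_add_one hlog8pos.le
    linarith
  have hLlow : Real.log (8 / η) ≤ L := Nat.le_ceil _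
  set n := ⌈36864 * (d : ℝ) / (η / (8 * L)) ^ 2⌉₊ with hn
  refine ⟨L, n, hL0, ?_, ?_, ?_⟩
  · have h1 : 8 / η ≤ 4 ^ L := by
      calc 8 / η = Real.exp (Real.log (8 / η)) := (Real.exp_log (by positivity)).symm
        _ ≤ Real.exp L := Real.exp_le_exp.2 hLlow
        _ = Real.exp 1 ^ L := by rw [← Real.exp_nat_mul, mul_one]
        _ ≤ 4 ^ L := pow_le_pow_left₀ (Real.exp_pos _).le
          (Real.exp_one_lt_d9.le.trans (by norm_num)) _
    rw [div_le_iff₀ hη] at h1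
    rw [div_le_iff₀ (by positivity)]
    linarith
  · have h1 : 36864 * (d : ℝ) / (η / (8 * L)) ^ 2 ≤ n := Nat.le_ceil _
    rw [div_le_iff₀ (by positivity)] at h1
    linarith
  · have h1 : 36864 * (d : ℝ) / (η / (8 * L)) ^ 2 = 2359296 * ((η ^ 2)⁻¹ * d * L ^ 2) := by
      field_simp; norm_num
    have h2 : (n : ℝ) < 36864 * (d : ℝ) / (η / (8 * L)) ^ 2 + 1 :=
      Nat.ceil_lt_add_one (by positivity)
    have hηinv : 1 ≤ (η ^ 2)⁻¹ := (one_le_inv₀ (by positivity)).2 (pow_le_one₀ hη.le hη1)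
    have h3 : (1 : ℝ) ≤ (η ^ 2)⁻¹ * d * L ^ 2 :=
      one_le_mul_of_one_le_of_one_le (one_le_mul_of_one_le_of_one_le hηinv hd0) (one_le_pow₀ hL1)
    have h4 : (η ^ 2)⁻¹ * d * (L : ℝ) ^ 2 ≤ (η ^ 2)⁻¹ * d * (5 * ℓ) ^ 2 := by gcongr
    have h5 : (η ^ 2)⁻¹ * d * (5 * ℓ) ^ 2 = 25 * ((η ^ 2)⁻¹ * d * ℓ ^ 2) := by ring
    linarith

/-- The proposition for a regular Bohr set, with the sample size `n` and the number `L` of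
averaging steps as parameters. -/
theorem exists_bohrSet_of_regular (K : Finset (AddChar G ℂ)) {ρ C η : ℝ} (hρ : 0 < ρ)
    (hρ1 : ρ ≤ 1) (hreg : IsRegularBohr K ρ) {A S : Finset G} (hA : A.Nonempty) (hS : S.Nonempty)
    (hSB : S ⊆ bohrSet K ρ) (hC1 : 1 ≤ C) (hC : ((A + S).card : ℝ) ≤ C * A.card) (hη : 0 < η)
    (hη1 : η ≤ 1) {d : ℕ} (hd : 1 ≤ d) (hvc : translateVCDim A ≤ d) {L n : ℕ} (hL0 : 0 < L)
    (hL : 2 / 4 ^ L ≤ η / 4) (hn : 36864 * (d : ℝ) ≤ (η / (8 * L)) ^ 2 * n) :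
    ∃ (K' : Finset (AddChar G ℂ)) (ρ' : ℝ) (l : ℕ), 0 < l ∧
      (l : ℝ) ≤ 8 * (Real.log 6 + n * Real.log C + Real.log ((bohrSet K ρ).card / S.card)) + 1 ∧
      K ⊆ K' ∧ (K'.card : ℝ) ≤ K.card + l ∧
      ρ * η / (3840000 * max 1 (K.card : ℝ) ^ 2 * l) ≤ ρ' ∧ ρ' ≤ ρ ∧ IsRegularBohr K' ρ' ∧
      ∀ x, ∀ t ∈ bohrSet K' ρ', |selfOverlap A (x + t) - selfOverlap A x| ≤ η := by
  classical
  obtain ⟨T, hTS, hTcard, hper⟩ := exists_almost_periods hA hd hvc hC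
    (by positivity : 0 < η / (8 * L)) hn
  have hC0 : 0 < C := by linarith
  have hS0 : (0 : ℝ) < S.card := by exact_mod_cast hS.card_pos
  have hT0 : (0 : ℝ) < T.card := by
    by_contra h
    have : 2 * C ^ n * T.card ≤ 0 :=
      mul_nonpos_of_nonneg_of_nonpos (by positivity) (not_lt.1 h)
    linarith
  have hT : T.Nonempty := Finset.card_pos.1 (by exact_mod_cast hT0)
  have hB0 := card_bohrSet_pos K hρ.le
  set E := Real.log (3 * (bohrSet K ρ).card / T.card) with hE
  have hTB : T ⊆ bohrSet K ρ := hTS.trans hSB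
  have hE0 : 0 < E := by
    refine Real.log_pos ?_
    rw [lt_div_iff₀ hT0]
    have : (T.card : ℝ) ≤ (bohrSet K ρ).card := by exact_mod_cast Finset.card_le_card hTB
    linarith
  have hEle : E ≤ Real.log 6 + n * Real.log C + Real.log ((bohrSet K ρ).card / S.card) := by
    rw [← Real.log_pow, ← Real.log_mul (by norm_num) (by positivity),
      ← Real.log_mul (by positivity) (by positivity)]
    refine Real.log_le_log (by positivity) ?_
    rw [mul_div_assoc', div_le_div_iff₀ hT0 hS0]
    calc 3 * ((bohrSet K ρ).card : ℝ) * S.card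
        ≤ 3 * ((bohrSet K ρ).card : ℝ) * (2 * C ^ n * T.card) := by gcongr
      _ = _ := by ring
  set l := ⌊8 * E⌋₊ + 1 with hl
  have hl1 : 8 * E < l := by rw [hl]; push_cast; exact Nat.lt_floor_add_one _
  have hl2 : (l : ℝ) ≤ 8 * E + 1 := by
    rw [hl]; push_cast
    gcongr
    exact Nat.floor_le (by positivity)
  obtain ⟨Λ, hΛ, hann⟩ := exists_annihilating_frequencies K hρ hρ1 hreg hTB hT hl1
  have hl0 : (0 : ℝ) < l := by linarith
  have hr1 : (1 : ℝ) ≤ max 1 (K.card : ℝ) := le_max_left _ _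
  set ρ₂ := ρ * (η / 4) / (480000 * max 1 (K.card : ℝ) ^ 2 * l) with hρ₂
  have hρ₂0 : 0 < ρ₂ := by positivity
  obtain ⟨ρ', h1, h2, hreg'⟩ := exists_isRegularBohr (K ∪ Λ) hρ₂0
  have hl1' : (1 : ℝ) ≤ l := by rw [hl]; push_cast; linarith [Nat.cast_nonneg (α := ℝ) ⌊8 * E⌋₊]
  refine ⟨K ∪ Λ, ρ', l, by omega, by linarith, Finset.subset_union_left, ?_, ?_, ?_, hreg', ?_⟩
  · have : (K ∪ Λ).card ≤ K.card + l := (Finset.card_union_le _ _).trans (by omega)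
    exact_mod_cast this
  · refine le_trans (le_of_eq ?_) h1
    rw [hρ₂]; field_simp; norm_num
  · refine h2.trans ?_
    rw [hρ₂, div_le_iff₀ (by positivity)]
    have h3 : (1 : ℝ) ≤ 480000 * max 1 (K.card : ℝ) ^ 2 * l :=
      one_le_mul_of_one_le_of_one_le
        (one_le_mul_of_one_le_of_one_le (by norm_num) (one_le_pow₀ hr1)) hl1'
    have h4 : η / 4 ≤ 480000 * max 1 (K.card : ℝ) ^ 2 * l := by linarith
    gcongr
  · intro x t ht
    have hspec := hann (η / 4) (by positivity) (by linarith) t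
      (bohrSet_mono subset_rfl h2 ht)
    have h3 := abs_selfOverlap_sub_le hA hT hper L hL hspec x
    have hL' : (0 : ℝ) < L := by exact_mod_cast hL0
    have h4 : 2 * (L * (2 * (η / (8 * L)))) = η / 2 := by field_simp; norm_num
    rw [h4] at h3
    linarith

end Main

theorem mainTheorem4 :
    ∃ C₀ c₀ : ℝ, 0 < C₀ ∧ 0 < c₀ ∧
      ∀ (G : Type*) [AddCommGroup G] [Fintype G] [DecidableEq G]
        (η ρ σ C : ℝ) (d : ℕ) (A S : Finset G) (K : Finset (AddChar G ℂ)),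
        0 < η → η ≤ 1 → 0 < ρ → ρ ≤ 1 → 0 < σ → σ ≤ 1 →
        A.Nonempty →
        translateVCDim A ≤ d →
        S ⊆ bohrSet K ρ →
        σ = (S.card : ℝ) / ((bohrSet K ρ).card : ℝ) →
        ((A + S).card : ℝ) ≤ C * (A.card : ℝ) →
        ∃ (K' : Finset (AddChar G ℂ)) (ρ' t' : ℝ),
          0 < t' ∧
          t' ≤ C₀ * (Real.log (2 / σ)
            + (η ^ 2)⁻¹ * (d : ℝ) * Real.log (2 / η) ^ 2 * Real.log C
            + irregularRank K ρ) ∧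
          K ⊆ K' ∧
          (K'.card : ℝ) ≤ (K.card : ℝ) + t' ∧
          c₀ * (ρ * η / ((max 1 (K.card : ℝ)) ^ 2 * t')) ≤ ρ' ∧
          ρ' ≤ ρ ∧
          IsRegularBohr K' ρ' ∧
          bohrSet K' ρ' ⊆ bohrSet K ρ ∧
          ∀ x : G, ∀ t ∈ bohrSet K' ρ',
            ‖normConv (charMeasure A) (indicatorFn (-A)) (x + t)
              - normConv (charMeasure A) (indicatorFn (-A)) x‖ ≤ η := by
  refine ⟨1000000000, 1 / 7680000, by norm_num, by norm_num, ?_⟩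
  intro G _ _ _ η ρ σ C d A S K hη hη1 hρ hρ1 hσ hσ1 hA hvc hSB hσeq hC
  have hB0 := card_bohrSet_pos K hρ.le
  have hA0 : (0 : ℝ) < A.card := by exact_mod_cast hA.card_pos
  have hS : S.Nonempty := by
    by_contra h
    rw [Finset.not_nonempty_iff_eq_empty.1 h] at hσeq
    simp at hσeq
    linarith
  have hC1 : 1 ≤ C := by
    have h1 : (A.card : ℝ) ≤ (A + S).card := by
      exact_mod_cast Finset.card_le_card_add_right hS
    by_contra! h
    have : C * A.card < 1 * A.card := by gcongr
    linarith
  have hlogC : 0 ≤ Real.log C := Real.log_nonneg hC1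
  have hκ : 0 ≤ irregularRank K ρ := by
    rw [irregularRank]; split_ifs <;> positivity
  have hlogσ : Real.log (2 / σ) = Real.log 2 + Real.log ((bohrSet K ρ).card / S.card) := by
    rw [hσeq, ← inv_div (S.card : ℝ), Real.log_div (by norm_num) (by rw [← hσeq]; exact hσ.ne'),
      Real.log_inv]
    ring
  have hlogσ0 : 0 ≤ Real.log ((bohrSet K ρ).card / S.card) := by
    rw [← inv_div, ← hσeq]
    exact Real.log_nonneg ((one_le_inv₀ hσ).2 hσ1)
  have hlog2 := Real.log_two_gt_d9
  have hr1 : (1 : ℝ) ≤ max 1 (K.card : ℝ) := le_max_left _ _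
  simp only [normConv_charMeasure_indicatorFn, ← Complex.ofReal_sub, Complex.norm_real,
    Real.norm_eq_abs]
  rcases Nat.eq_zero_or_pos d with rfl | hd
  · obtain ⟨ρ', h1, h2, hreg⟩ := exists_isRegularBohr K hρ
    refine ⟨K, ρ', 1, one_pos, ?_, subset_rfl, by linarith, ?_, h2, hreg,
      bohrSet_mono subset_rfl h2, ?_⟩
    · simp only [Nat.cast_zero, mul_zero, zero_mul, add_zero]
      linarith
    · refine le_trans ?_ h1
      have h3 : ρ * η / (max 1 (K.card : ℝ) ^ 2 * 1) ≤ ρ := by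
        rw [mul_one]
        exact (div_le_self (by positivity) (one_le_pow₀ hr1)).trans
          (mul_le_of_le_one_right hρ.le hη1)
      linarith
    · intro x t _
      rw [selfOverlap_eq_one_of_vcDim_eq_zero hA (Nat.le_zero.1 hvc),
        selfOverlap_eq_one_of_vcDim_eq_zero hA (Nat.le_zero.1 hvc)]
      simpa using hη.le
  obtain ⟨ρ₁, S₁, hρ₁low, hρ₁up, hreg₁, hS₁, hS₁B, hC', hdens⟩ :=
    exists_regular_relative_subset K hρ A hS hSB hC
  obtain ⟨L, n, hL0, hL, hn, hnle⟩ := exists_steps_and_sample_size hη hη1 hd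
  obtain ⟨K', ρ', l, hl0, hlle, hKK', hK'card, hρ'low, hρ'up, hreg', hfin⟩ :=
    exists_bohrSet_of_regular K (by linarith) (hρ₁up.trans hρ1) hreg₁ hA hS₁ hS₁B hC1 hC' hη hη1
      hd hvc hL0 hL hn
  have hl0' : (0 : ℝ) < l := by exact_mod_cast hl0
  refine ⟨K', ρ', l, hl0', ?_, hKK', hK'card, ?_, hρ'up.trans hρ₁up, hreg',
    bohrSet_mono hKK' (hρ'up.trans hρ₁up), hfin⟩
  · have h1 : (n : ℝ) * Real.log C ≤
        120000000 * ((η ^ 2)⁻¹ * d * Real.log (2 / η) ^ 2) * Real.log C := by gcongr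
    have h2 : 0 ≤ (η ^ 2)⁻¹ * d * Real.log (2 / η) ^ 2 * Real.log C := by positivity
    have h6 : Real.log 6 ≤ 3 * Real.log 2 := by
      rw [← Real.log_rpow (by norm_num)]
      exact Real.log_le_log (by norm_num) (by norm_num)
    linarith
  · refine le_trans ?_ hρ'low
    have h1 : ρ / 2 * η / (3840000 * max 1 (K.card : ℝ) ^ 2 * l)
        ≤ ρ₁ * η / (3840000 * max 1 (K.card : ℝ) ^ 2 * l) := by gcongr
    refine le_trans (le_of_eq ?_) h1
    field_simp
    norm_num
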